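/- Let $\Sigma$ be the plane $\mathbb{R}^2$ or the sphere $S^2$, with its standard orientation, and let $D$ be a link diagram on $\Sigma$: the image of finitely many smoothly immersed closed curves (the link components), whose only singular points are transverse double points (the crossings), with over/under information at each crossing. The regions of $D$ are the connected components of the complement of this image in $\Sigma$. Let $x_1,\dots,x_n$, $n\ge 1$, be the crossings of $D$ and let $\mathcal{R}$ be the set of its regions (it is finite; if the image has $d$ connected components, there are $n+d+1$ regions). The underpass and the overpass cut a neighbourhood of a crossing into four corners. A corner is positive if it is swept out by turning the underpass counterclockwise to the overpass, and negative if it is swept out by turning the underpass clockwise to the overpass; opposite corners have the same sign. For a crossing $x_i$ and a region $R$ put $a^{(a1)}_{iR}=1$ if $R$ touches $x_i$ at a positive corner, $a^{(a1)}_{iR}=-1$ if $R$ touches $x_i$ at a negative corner, and $a^{(a1)}_{iR}=0$ if $R$ does not touch $x_i$. Put $a^{(a2)}_{iR}=2a^{(a1)}_{iR}$ if $R$ touches $x_i$ at two opposite corners, and $a^{(a2)}_{iR}=a^{(a1)}_{iR}$ otherwise. The alternating region choice matrix of the double counting rule is $A_{a2}(D)=(a^{(a2)}_{iR})$. Let $x$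 be a crossing of $D$ at which two arcs of the same link component meet. Then there exists $\mathbf{v}_x\in\mathbb{Z}^{\mathcal{R}}$ such that the component of $A_{a2}(D)\mathbf{v}_x$ corresponding to $x$ is $1$ and all its other components are $0$. -/

import Mathlib

open Set Filter Topology
open scoped ContDiff

/-- Euclidean 3-space. -/
abbrev E3 : Type := EuclideanSpace ℝ (Fin 3)

/-- The two surfaces on which link diagrams are drawn: the plane `ℝ²`, realised as the
coordinate plane `z = 0` of `ℝ³`, and the unit sphere `S²` of `ℝ³`. -/
inductive DiagramSurface : Type
  | plane
  | sphere

namespace DiagramSurface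

/-- The points of the surface. -/
def carrier : DiagramSurface → Set E3
  | plane => {p | p 2 = 0}
  | sphere => Metric.sphere 0 1

/-- The unit normal at a point of the surface, pointing towards the viewer: upwards for the
plane and outwards for the sphere. -/
noncomputable def normal : DiagramSurface → E3 → E3
  | plane, _ => EuclideanSpace.single 2 1
  | sphere, p => p

/-- The oriented area `det (ν, u, v)` of two tangent vectors `u`, `v` at `p`; it is positive
when, for the viewer, `v` is obtained from `u` by turning counterclockwise by an angle
strictly between `0` and `π`. -/
noncomputable def area (S : DiagramSurface) (p u v : E3) : ℝ :=
  Matrix.det (Matrix.of fun i j : Fin 3 => (![S.normal p, u, v] i) j)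

/-- The nearest-point retraction onto the surface. It is applied here only to points
`p + t • w` with `p` on the surface and `w` tangent to it at `p`. -/
noncomputable def retract : DiagramSurface → E3 → E3
  | plane, p => p - (p 2) • EuclideanSpace.single 2 (1 : ℝ)
  | sphere, p => ‖p‖⁻¹ • p

end DiagramSurface

/-- A link diagram on the plane or on the sphere, given by a parametrisation: `l` smoothly
immersed closed curves (one for each link component), whose only singular points are
transverse double points, with over/under information at each double point. -/
structure LinkDiagram (S : DiagramSurface) where
  /-- The number of link components. -/
  l : ℕ
  /-- The projected link components, parametrised by the circle `ℝ / ℤ`. -/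
  curve : Fin l → UnitAddCircle → E3
  mem_carrier : ∀ i θ, curve i θ ∈ S.carrier
  smooth : ∀ i, ContDiff ℝ ∞ (fun t : ℝ => curve i (t : UnitAddCircle))
  immersed : ∀ i θ, deriv (fun t : ℝ => curve i (θ + (t : UnitAddCircle))) 0 ≠ 0
  /-- No point of the surface is passed more than twice. -/
  double : ∀ p q r : Fin l × UnitAddCircle,
    curve p.1 p.2 = curve q.1 q.2 → curve q.1 q.2 = curve r.1 r.2 → p = q ∨ q = r ∨ p = r
  transverse : ∀ p q : Fin l × UnitAddCircle, p ≠ q → curve p.1 p.2 = curve q.1 q.2 →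
    LinearIndependent ℝ
      ![deriv (fun t : ℝ => curve p.1 (p.2 + (t : UnitAddCircle))) 0,
        deriv (fun t : ℝ => curve q.1 (q.2 + (t : UnitAddCircle))) 0]
  /-- The over/under information: the parameters of overpasses. (Whether a parameter that is
  not over a double point belongs to this set is irrelevant.) -/
  overpass : Set (Fin l × UnitAddCircle)
  overpass_iff : ∀ p q : Fin l × UnitAddCircle, p ≠ q → curve p.1 p.2 = curve q.1 q.2 →
    (p ∈ overpass ↔ q ∉ overpass)

namespace LinkDiagram

variable {S : DiagramSurface} (D : LinkDiagram S)

/-- The points of the link, as pairs of a link component and a parameter on it. -/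
abbrev Param : Type := Fin D.l × UnitAddCircle

/-- The projection of a point of the link to the surface. -/
def proj (p : D.Param) : E3 := D.curve p.1 p.2

/-- The velocity of the projected link at a point. -/
noncomputable def velocity (p : D.Param) : E3 :=
  deriv (fun t : ℝ => D.curve p.1 (p.2 + (t : UnitAddCircle))) 0

/-- The complement of the projection image in the surface. -/
def complement : Set E3 := S.carrier \ range D.proj

/-- A region: a connected component of the complement of the projection image. -/
def Region : Type := {R : Set E3 // ∃ p ∈ D.complement, R = connectedComponentIn D.complement p}

/-- A crossing: a double point of the projection, recorded by its two preimages, the first on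
the overpass and the second on the underpass. -/
@[ext]
structure Crossing where
  overPt : D.Param
  underPt : D.Param
  meet : D.proj overPt = D.proj underPt
  over_mem : overPt ∈ D.overpass
  under_not_mem : underPt ∉ D.overpass

namespace Crossing

variable {D}

/-- The location of the crossing on the surface. -/
def pt (x : D.Crossing) : E3 := D.proj x.underPt

/-- The two arcs meeting at the crossing belong to the same link component. -/
def IsSelfCrossing (x : D.Crossing) : Prop := x.overPt.1 = x.underPt.1

/-- The four corners at a crossing: `(σ, τ)` stands for the corner between the half `σ u` of
the underpass and the half `τ o` of the overpass, where `u` and `o` are the velocities of the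
two passes. The opposite corner is `-(σ, τ)`. -/
abbrev Corner : Type := ℤˣ × ℤˣ

/-- The half of the underpass bounding a corner. -/
noncomputable def underDir (x : D.Crossing) (κ : Corner) : E3 := (κ.1 : ℤ) • D.velocity x.underPt

/-- The half of the overpass bounding a corner. -/
noncomputable def overDir (x : D.Crossing) (κ : Corner) : E3 := (κ.2 : ℤ) • D.velocity x.overPt

/-- The corner lies between the underpass and the overpass counterclockwise: turning the
underpass counterclockwise to the overpass sweeps out the corner. -/
def PosCorner (x : D.Crossing) (κ : Corner) : Prop := 0 < S.area x.pt (x.underDir κ) (x.overDir κ)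

/-- The corner lies between the underpass and the overpass clockwise. -/
def NegCorner (x : D.Crossing) (κ : Corner) : Prop := S.area x.pt (x.underDir κ) (x.overDir κ) < 0

/-- The region `R` touches the crossing `x` at the corner `κ`: on leaving `x` in a direction
inside the corner one is in `R`. -/
def Touches (x : D.Crossing) (R : D.Region) (κ : Corner) : Prop :=
  ∀ᶠ t : ℝ in 𝓝[>] 0, S.retract (x.pt + t • (x.underDir κ + x.overDir κ)) ∈ R.1

end Crossing

open Classical in
/-- The alternating region choice matrix of the single counting rule. -/
noncomputable def altMatrix1 : Matrix D.Crossing D.Region ℤ := Matrix.of fun x R =>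
  if ∃ κ, x.PosCorner κ ∧ x.Touches R κ then 1
  else if ∃ κ, x.NegCorner κ ∧ x.Touches R κ then -1
  else 0

open Classical in
/-- The alternating region choice matrix of the double counting rule. -/
noncomputable def altMatrix2 : Matrix D.Crossing D.Region ℤ := Matrix.of fun x R =>
  if ∃ κ, x.Touches R κ ∧ x.Touches R (-κ) then 2 * D.altMatrix1 x R
  else D.altMatrix1 x R

/-- The product of the alternating region choice matrix of the double counting rule with an
integral vector indexed by the regions. -/
noncomputable def altMatrix2MulVec (v : D.Region → ℤ) (x : D.Crossing) : ℤ :=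
  ∑ᶠ R : D.Region, D.altMatrix2 x R * v R

/-- Only one region touches a crossing at a given corner. -/
theorem Crossing.Touches.unique {D : LinkDiagram S} {x : D.Crossing} {R R' : D.Region}
    {κ : Crossing.Corner} (h : x.Touches R κ) (h' : x.Touches R' κ) : R = R' := by
  obtain ⟨t, h1, h2⟩ := (h.and h').exists
  obtain ⟨R, p, hp, rfl⟩ := R
  obtain ⟨R', p', hp', rfl⟩ := R'
  apply Subtype.ext
  exact (connectedComponentIn_eq h1).trans (connectedComponentIn_eq h2).symm

/-- The sum defining a component of the matrix product has finitely many nonzero terms,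
whatever the vector is. -/
theorem finite_support_altMatrix2 (v : D.Region → ℤ) (x : D.Crossing) :
    (Function.support fun R : D.Region => D.altMatrix2 x R * v R).Finite := by
  have hfin : (⋃ κ : Crossing.Corner, {R : D.Region | x.Touches R κ}).Finite := by
    refine Set.finite_iUnion fun κ => Set.Subsingleton.finite ?_
    intro R hR R' hR'
    exact Crossing.Touches.unique hR hR'
  refine hfin.subset fun R hR => ?_
  by_contra hcon
  have hno : ∀ κ, ¬ x.Touches R κ := fun κ hκ => hcon (Set.mem_iUnion.2 ⟨κ, hκ⟩)
  apply hR
  simp [altMatrix2, altMatrix1, hno]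

end LinkDiagram

/-! Leave the self-crossing `x` along its overpass and follow the component until it returns to `x`
on the underpass. The projection of this arc is a closed loop whose only corner is at `x`. The
vector sought is, up to sign, the winding number of this loop about the points of each region.

A region meets a crossing only at corners of one sign, so under the double counting rule each row of
the matrix, applied to `v`, is up to sign the alternating sum of `v` over the four corners. At a
crossing other than `x`, each strand lies locally either in the loop or off it. Near that crossing
`v` is a function of the side of the underpass plus a function of the side of the overpass, and the
alternating sum vanishes. At `x` the loop turns from the underpass into the overpass; the corner
enclosed by the turn has index differing by one from the other three, and the alternating sum is
`±1`.

Winding numbers are Cauchy integrals in a planar chart. `exp_integral_kernel` makes them integral,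
and continuity makes them constant on regions (`exists_regionIndex`). On the sphere the chart is
stereographic from a point off the link; the integral vanishes at infinity, so the pole does no
harm. The values at the corners are limits of the integral as its point tends to the crossing
(`tendsto_logInt_doublePoint`), which reduces the claim to arguments of four directions
(`log_sub_log_left`, `log_sub_log_right`, `altSum_turn`). The same limits for the whole link give
`Touches.sign_unique`. -/

/-! ### Logarithmic integrals near the end of an arc -/

theorem Complex.smul_add_mem_slitPlane {z : ℂ} (hz : z ∈ Complex.slitPlane) {s t : ℝ} (hs : 0 ≤ s)
    (ht : 0 < t) : (s : ℂ) * z + t ∈ Complex.slitPlane := by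
  rcases hs.eq_or_lt with rfl | hs
  · simpa [Complex.mem_slitPlane_iff] using ht
  · rw [Complex.mem_slitPlane_iff] at hz ⊢
    rcases hz with h | h
    · left
      simp only [Complex.add_re, Complex.re_ofReal_mul, Complex.ofReal_re]
      positivity
    · right
      simp [hs.ne', h]

/-- The argument of `f x` is close to `0`, so adding `arg a` does not leave `(-π, π)`. A positive
factor does not change arguments, which makes the statement uniform in `r`. -/
theorem Complex.eventually_log_mul {α : Type*} {l : Filter α} {f : α → ℂ} {a : ℂ}
    (hf : Tendsto f l (𝓝 1)) (ha : a ∈ Complex.slitPlane) :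
    ∀ᶠ x in l, ∀ r : ℝ, 0 < r →
      Complex.log (r * f x * a) = Complex.log (r * f x) + Complex.log a := by
  have hne : ∀ᶠ x in l, f x ≠ 0 := hf.eventually_ne one_ne_zero
  have harg : Tendsto (fun x => (f x).arg + a.arg) l (𝓝 (Complex.arg 1 + a.arg)) :=
    ((Complex.continuousAt_arg (by simp)).tendsto.comp hf).add_const _
  have hIoo : Complex.arg 1 + a.arg ∈ Ioo (-Real.pi) Real.pi := by
    rw [Complex.arg_one, zero_add]
    exact ⟨Complex.neg_pi_lt_arg a,
      lt_of_le_of_ne (Complex.arg_le_pi a) (Complex.mem_slitPlane_iff_arg.1 ha).1⟩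
  filter_upwards [hne, harg.eventually (Ioo_mem_nhds hIoo.1 hIoo.2)] with x h0 h1 r hr
  refine Complex.log_mul (mul_ne_zero (by exact_mod_cast hr.ne') h0) (Complex.slitPlane_ne_zero ha)
    ?_
  rw [Complex.arg_real_mul _ hr]
  exact ⟨h1.1, h1.2.le⟩

/-- The asymptotics of the logarithmic integral along an arc that leaves the point `G 0`, when the
pole approaches this point along a curve with a different direction. -/
theorem tendsto_integral_inv_sub_halfBranch {G G' : ℝ → ℂ} (hG : ∀ s, HasDerivAt G (G' s) s)
    (hG' : Continuous G') (h0 : G' 0 ≠ 0) {d : ℝ → ℂ} {d₀ : ℂ}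
    (hd : Tendsto d (𝓝[>] 0) (𝓝 d₀)) (hs : -G' 0 / d₀ ∈ Complex.slitPlane) :
    ∀ᶠ ε in 𝓝[>] (0 : ℝ),
      (∀ᶠ t in 𝓝[>] (0 : ℝ), ∀ s ∈ Icc 0 ε, G s ≠ G 0 + t * d t) ∧
      Tendsto (fun t : ℝ => (∫ s in (0 : ℝ)..ε, G' s / (G s - (G 0 + t * d t))) + (Real.log t : ℂ))
        (𝓝[>] 0) (𝓝 (Complex.log ((G ε - G 0) / G' 0) + Complex.log (-G' 0 / d₀))) := by
  have hd₀ : d₀ ≠ 0 := by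
    rintro rfl
    simp at hs
  set g : ℝ → ℂ := fun s => (G s - G 0) / s with hg
  have hgl : Tendsto g (𝓝[>] 0) (𝓝 (G' 0)) := by
    have h1 := (hasDerivAt_iff_tendsto_slope.1 (hG 0)).mono_left
      (nhdsWithin_mono 0 (fun x (hx : x ∈ Ioi (0 : ℝ)) => ne_of_gt hx))
    refine h1.congr fun s => ?_
    simp [hg, slope, div_eq_inv_mul]
  have hGs : ∀ s : ℝ, 0 ≤ s → G s = G 0 + s * g s := by
    intro s hs
    rcases hs.eq_or_lt with rfl | hs
    · simp
    · have : (s : ℂ) ≠ 0 := by exact_mod_cast hs.ne'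
      simp only [hg]
      field_simp
      ring
  have hprod : ∀ᶠ st : ℝ × ℝ in 𝓝[>] 0 ×ˢ 𝓝[>] 0,
      -g st.1 / d st.2 ∈ Complex.slitPlane := by
    have : Tendsto (fun st : ℝ × ℝ => -g st.1 / d st.2) (𝓝[>] 0 ×ˢ 𝓝[>] 0)
        (𝓝 (-G' 0 / d₀)) :=
      ((hgl.comp tendsto_fst).neg).div (hd.comp tendsto_snd) hd₀
    exact this.eventually (Complex.isOpen_slitPlane.mem_nhds hs)
  obtain ⟨pa, hpa, pb, hpb, hab⟩ := eventually_prod_iff.1 hprod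
  obtain ⟨δ, hδ, hδa⟩ := mem_nhdsGT_iff_exists_Ioo_subset.1 hpa
  have hone : Tendsto (fun s => g s / G' 0) (𝓝[>] 0) (𝓝 1) := by
    simpa [h0] using hgl.div_const (G' 0)
  have hlim : ∀ᶠ ε in 𝓝[>] (0 : ℝ), -g ε / d₀ ∈ Complex.slitPlane :=
    ((hgl.neg).div_const d₀).eventually (Complex.isOpen_slitPlane.mem_nhds hs)
  filter_upwards [Ioo_mem_nhdsGT hδ, Complex.eventually_log_mul hone hs, hlim]
    with ε hε hlog hεlim
  have hεpos : (0 : ℝ) < ε := hε.1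
  have hslit : ∀ᶠ t in 𝓝[>] (0 : ℝ), 0 < t ∧ d t ≠ 0 ∧ ∀ s ∈ Icc 0 ε,
      -(G s - (G 0 + t * d t)) / d t ∈ Complex.slitPlane := by
    filter_upwards [hpb, self_mem_nhdsWithin, hd.eventually_ne hd₀] with t ht ht0 hdt
    refine ⟨ht0, hdt, fun s hs => ?_⟩
    -- A nonnegative multiple of a point of the slit plane plus a positive real stays in the slit
    -- plane, so the principal logarithm of this quotient is a primitive along the whole arc.
    have heq : -(G s - (G 0 + t * d t)) / d t = s * (-g s / d t) + t := by
      rw [hGs s hs.1]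
      field_simp
      ring
    rw [heq]
    rcases hs.1.eq_or_lt with h | h
    · subst h
      simpa [Complex.mem_slitPlane_iff] using ht0
    · exact Complex.smul_add_mem_slitPlane (hab (hδa ⟨h, hs.2.trans_lt hε.2⟩) ht) hs.1 ht0
  constructor
  · filter_upwards [hslit] with t ht s hs heq
    have := ht.2.2 s hs
    rw [heq] at this
    simp at this
  · have hval : ∀ᶠ t in 𝓝[>] (0 : ℝ), Complex.log (-(G ε - (G 0 + t * d t)) / d t) =
        (∫ s in (0 : ℝ)..ε, G' s / (G s - (G 0 + t * d t))) + (Real.log t : ℂ) := by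
      filter_upwards [hslit] with t ⟨ht, hdt, hm⟩
      have hne : ∀ s ∈ Icc 0 ε, G s - (G 0 + t * d t) ≠ 0 := by
        intro s hs h
        have := hm s hs
        rw [h] at this
        simp at this
      have hint := intervalIntegral.integral_eq_sub_of_hasDerivAt
        (f := fun s => Complex.log (-(G s - (G 0 + t * d t)) / d t))
        (f' := fun s => G' s / (G s - (G 0 + t * d t))) (a := 0) (b := ε) ?_ ?_
      · rw [hint]
        -- At the end `s = 0` the primitive equals `log t`; this is the divergent term.
        have : -(G 0 - (G 0 + t * d t)) / d t = t := by
          field_simp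
          ring
        rw [this, Complex.ofReal_log ht.le]
        ring
      · intro s hs
        rw [uIcc_of_le hεpos.le] at hs
        have h1 := ((((hG s).sub_const (G 0 + t * d t)).neg).div_const (d t)).clog_real (hm s hs)
        rw [Pi.neg_apply, div_div_div_cancel_right₀ hdt, neg_div_neg_eq] at h1
        exact h1
      · apply ContinuousOn.intervalIntegrable
        rw [uIcc_of_le hεpos.le]
        refine hG'.continuousOn.div ?_ hne
        exact fun s _ => ((hG s).continuousAt.sub continuousAt_const).continuousWithinAt
    refine Tendsto.congr' hval ?_
    have hGε := hGs ε hεpos.le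
    have hεC : (ε : ℂ) ≠ 0 := by exact_mod_cast hεpos.ne'
    -- The splitting separates the part depending on `ε` from the part depending on the direction
    -- `d₀`, so that different directions can be compared.
    have heq : Complex.log ((G ε - G 0) / G' 0) + Complex.log (-G' 0 / d₀) =
        Complex.log (-(G ε - G 0) / d₀) := by
      have h1 : (G ε - G 0) / G' 0 = ε * (g ε / G' 0) := by
        rw [hGε]; ring
      have h2 : -(G ε - G 0) / d₀ = ε * (g ε / G' 0) * (-G' 0 / d₀) := by
        rw [hGε]; field_simp; ring
      rw [h1, h2, hlog ε hεpos]
    rw [heq]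
    have ht0 : Tendsto (fun t : ℝ => (t : ℂ)) (𝓝[>] 0) (𝓝 0) := by
      have : Tendsto (fun t : ℝ => (t : ℂ)) (𝓝 0) (𝓝 ((0 : ℝ) : ℂ)) :=
        Complex.continuous_ofReal.tendsto 0
      simpa using this.mono_left nhdsWithin_le_nhds
    have hlim2 : Tendsto (fun t => -(G ε - (G 0 + t * d t)) / d t) (𝓝[>] (0 : ℝ))
        (𝓝 (-(G ε - (G 0 + 0 * d₀)) / d₀)) :=
      (((tendsto_const_nhds.add (ht0.mul hd)).const_sub _).neg).div hd hd₀
    rw [zero_mul, add_zero] at hlim2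
    refine hlim2.clog ?_
    have : -(G ε - G 0) / d₀ = ε * (-g ε / d₀) := by
      rw [hGε]; ring
    rw [this, Complex.mem_slitPlane_iff] at *
    simpa [hεpos, hεpos.ne'] using hεlim

/-! ### Weighted Cauchy integrals along closed curves -/

/-- Finitely many continuously differentiable closed curves in the complex plane. -/
structure PlanarCurves (l : ℕ) where
  /-- The position. -/
  pos : Fin l × UnitAddCircle → ℂ
  /-- The velocity. -/
  vel : Fin l × UnitAddCircle → ℂ
  continuous_pos : Continuous pos
  continuous_vel : Continuous vel
  hasDerivAt : ∀ (k : Fin l) (s : ℝ),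
    HasDerivAt (fun s : ℝ => pos (k, (s : UnitAddCircle))) (vel (k, (s : UnitAddCircle))) s

namespace PlanarCurves

variable {l : ℕ} (Γ : PlanarCurves l)

/-- The logarithmic form with pole `z` along the curves. -/
noncomputable def kernel (z : ℂ) (q : Fin l × UnitAddCircle) : ℂ := Γ.vel q / (Γ.pos q - z)

/-- The integral of the logarithmic form with pole `z` along the curves with weight `χ`. -/
noncomputable def logInt (χ : Fin l × UnitAddCircle → ℂ) (z : ℂ) : ℂ :=
  ∑ k, ∫ θ : UnitAddCircle, χ (k, θ) * Γ.kernel z (k, θ)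

/-- Bounded measurable weights. -/
structure IsWeight (χ : Fin l × UnitAddCircle → ℂ) : Prop where
  measurable : Measurable χ
  norm_le_one : ∀ q, ‖χ q‖ ≤ 1

theorem IsWeight.indicator {χ : Fin l × UnitAddCircle → ℂ} (hχ : IsWeight χ)
    {A : Set (Fin l × UnitAddCircle)} (hA : MeasurableSet A) : IsWeight (A.indicator χ) :=
  ⟨hχ.measurable.indicator hA, fun q => (norm_indicator_le_norm_self _ _).trans (hχ.norm_le_one q)⟩

theorem IsWeight.one : IsWeight (fun _ : Fin l × UnitAddCircle => (1 : ℂ)) :=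
  ⟨measurable_const, by simp⟩

theorem measurable_kernel (z : ℂ) : Measurable (Γ.kernel z) :=
  Γ.continuous_vel.measurable.div (Γ.continuous_pos.measurable.sub_const z)

theorem continuous_pos_lift (k : Fin l) :
    Continuous (fun s : ℝ => Γ.pos (k, (s : UnitAddCircle))) :=
  Γ.continuous_pos.comp (continuous_const.prodMk (AddCircle.continuous_mk' 1))

theorem continuous_vel_lift (k : Fin l) :
    Continuous (fun s : ℝ => Γ.vel (k, (s : UnitAddCircle))) :=
  Γ.continuous_vel.comp (continuous_const.prodMk (AddCircle.continuous_mk' 1))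

theorem exists_norm_vel_le : ∃ M : ℝ, 0 < M ∧ ∀ q, ‖Γ.vel q‖ ≤ M := by
  obtain ⟨M, hM⟩ := (isCompact_range Γ.continuous_vel).isBounded.exists_norm_le
  exact ⟨max M 1, by positivity, fun q => (hM _ (mem_range_self q)).trans (le_max_left _ _)⟩

theorem exists_norm_pos_le : ∃ M : ℝ, 0 < M ∧ ∀ q, ‖Γ.pos q‖ ≤ M := by
  obtain ⟨M, hM⟩ := (isCompact_range Γ.continuous_pos).isBounded.exists_norm_le
  exact ⟨max M 1, by positivity, fun q => (hM _ (mem_range_self q)).trans (le_max_left _ _)⟩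

theorem norm_weight_mul_kernel_le {χ : Fin l × UnitAddCircle → ℂ} (hχ : IsWeight χ) {M δ : ℝ}
    (hM : ∀ q, ‖Γ.vel q‖ ≤ M) (hM0 : 0 < M) (hδ : 0 < δ) {z : ℂ} {q : Fin l × UnitAddCircle}
    (hz : χ q ≠ 0 → δ ≤ ‖Γ.pos q - z‖) : ‖χ q * Γ.kernel z q‖ ≤ M / δ := by
  by_cases h : χ q = 0
  · simp only [h, zero_mul, norm_zero]
    positivity
  · rw [norm_mul, kernel, norm_div]
    calc ‖χ q‖ * (‖Γ.vel q‖ / ‖Γ.pos q - z‖) ≤ 1 * (M / δ) := by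
          gcongr
          · exact hχ.norm_le_one q
          · exact hM q
          · exact hz h
      _ = M / δ := one_mul _

theorem aestronglyMeasurable_weight_mul_kernel {χ : Fin l × UnitAddCircle → ℂ} (hχ : IsWeight χ)
    (z : ℂ) (k : Fin l) : MeasureTheory.AEStronglyMeasurable
      (fun θ : UnitAddCircle => χ (k, θ) * Γ.kernel z (k, θ)) MeasureTheory.volume :=
  ((hχ.measurable.mul (Γ.measurable_kernel z)).comp measurable_prodMk_left).aestronglyMeasurable

theorem exists_dist_of_notMem_range {z : ℂ} (hz : z ∉ range Γ.pos) :
    ∃ δ > 0, ∀ q, δ ≤ ‖Γ.pos q - z‖ := by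
  have hcl : IsClosed (range Γ.pos) := (isCompact_range Γ.continuous_pos).isClosed
  obtain ⟨δ, hδ, hb⟩ := Metric.isOpen_iff.1 hcl.isOpen_compl z hz
  refine ⟨δ, hδ, fun q => ?_⟩
  by_contra! h
  exact hb (show Γ.pos q ∈ Metric.ball z δ by rwa [Metric.mem_ball, dist_eq_norm])
    (mem_range_self q)

theorem integrable_weight_mul_kernel {χ : Fin l × UnitAddCircle → ℂ} (hχ : IsWeight χ)
    {z : ℂ} (hz : z ∉ range Γ.pos) (k : Fin l) : MeasureTheory.Integrable
      (fun θ : UnitAddCircle => χ (k, θ) * Γ.kernel z (k, θ)) MeasureTheory.volume := by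
  obtain ⟨δ, hδ, h⟩ := Γ.exists_dist_of_notMem_range hz
  obtain ⟨M, hM0, hM⟩ := Γ.exists_norm_vel_le
  exact MeasureTheory.Integrable.of_bound (Γ.aestronglyMeasurable_weight_mul_kernel hχ z k) (M / δ)
    (Eventually.of_forall fun θ =>
      Γ.norm_weight_mul_kernel_le hχ hM hM0 hδ fun _ => h _)

/-- Dominated convergence. The distance bound is asked only on the support of the weight, so `z₀`
may be a double point once the weight is cut off near it. -/
theorem continuousAt_logInt {χ : Fin l × UnitAddCircle → ℂ} (hχ : IsWeight χ) {z₀ : ℂ} {δ : ℝ}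
    (hδ : 0 < δ) (hz : ∀ q, χ q ≠ 0 → δ ≤ ‖Γ.pos q - z₀‖) : ContinuousAt (Γ.logInt χ) z₀ := by
  obtain ⟨M, hM0, hM⟩ := Γ.exists_norm_vel_le
  unfold logInt
  refine tendsto_finsetSum _ fun k _ => ?_
  refine MeasureTheory.continuousAt_of_dominated (bound := fun _ => M / (δ / 2))
    (Eventually.of_forall fun z => Γ.aestronglyMeasurable_weight_mul_kernel hχ z k) ?_
    (MeasureTheory.integrable_const _) ?_
  · filter_upwards [Metric.ball_mem_nhds z₀ (half_pos hδ)] with z hzz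
    refine Eventually.of_forall fun θ => Γ.norm_weight_mul_kernel_le hχ hM hM0 (half_pos hδ) ?_
    intro h
    have h1 := hz _ h
    rw [Metric.mem_ball, dist_eq_norm] at hzz
    have h2 := norm_sub_le_norm_sub_add_norm_sub (Γ.pos (k, θ)) z z₀
    linarith
  · refine Eventually.of_forall fun θ => ?_
    by_cases h : χ (k, θ) = 0
    · simp only [h, zero_mul]
      exact continuousAt_const
    · refine continuousAt_const.mul (continuousAt_const.div
        (continuousAt_const.sub continuousAt_id) ?_)
      have := hz _ h
      exact norm_pos_iff.1 (hδ.trans_le this)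

theorem tendsto_logInt_cocompact {χ : Fin l × UnitAddCircle → ℂ} (hχ : IsWeight χ) :
    Tendsto (Γ.logInt χ) (cocompact ℂ) (𝓝 0) := by
  obtain ⟨M, hM0, hM⟩ := Γ.exists_norm_vel_le
  obtain ⟨B, hB0, hB⟩ := Γ.exists_norm_pos_le
  have h0 : Tendsto (fun z : ℂ => ‖z‖ - B) (cocompact ℂ) atTop :=
    tendsto_atTop_add_const_right _ _ (tendsto_norm_cocompact_atTop)
  have h1 : Tendsto (fun z : ℂ => ∑ _k : Fin l, M / (‖z‖ - B)) (cocompact ℂ) (𝓝 0) := by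
    simpa using tendsto_finsetSum (Finset.univ : Finset (Fin l))
      (fun _ _ => h0.const_div_atTop M)
  refine squeeze_zero_norm' ?_ h1
  filter_upwards [h0.eventually_gt_atTop 0] with z hz
  refine (norm_sum_le _ _).trans (Finset.sum_le_sum fun k _ => ?_)
  have := MeasureTheory.norm_integral_le_of_norm_le_const
    (μ := (MeasureTheory.volume : MeasureTheory.Measure UnitAddCircle))
    (f := fun θ => χ (k, θ) * Γ.kernel z (k, θ)) (C := M / (‖z‖ - B))
    (Eventually.of_forall fun θ => Γ.norm_weight_mul_kernel_le hχ hM hM0 hz fun _ => by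
      have h2 := norm_sub_norm_le z (Γ.pos (k, θ))
      rw [norm_sub_rev] at h2
      have := hB (k, θ)
      linarith)
  simpa [MeasureTheory.Measure.real, UnitAddCircle.measure_univ] using this

theorem logInt_indicator_add_compl {χ : Fin l × UnitAddCircle → ℂ} (hχ : IsWeight χ)
    {A : Set (Fin l × UnitAddCircle)} (hA : MeasurableSet A) {z : ℂ} (hz : z ∉ range Γ.pos) :
    Γ.logInt (A.indicator χ) z + Γ.logInt (Aᶜ.indicator χ) z = Γ.logInt χ z := by
  unfold logInt
  rw [← Finset.sum_add_distrib]
  refine Finset.sum_congr rfl fun k _ => ?_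
  rw [← MeasureTheory.integral_add (Γ.integrable_weight_mul_kernel (hχ.indicator hA) hz k)
    (Γ.integrable_weight_mul_kernel (hχ.indicator hA.compl) hz k)]
  refine MeasureTheory.integral_congr_ae (Eventually.of_forall fun θ => ?_)
  simp only [← add_mul, indicator_self_add_compl_apply]

/-- The arc from `a` to `b` on the component `k`. -/
def arc (k : Fin l) (a b : ℝ) : Set (Fin l × UnitAddCircle) :=
  {k} ×ˢ ((fun s : ℝ => (s : UnitAddCircle)) '' Ioc a b)

theorem coe_mem_image_Ioc_iff {a b s : ℝ} (hab : b ≤ a + 1) (hs : s ∈ Ioc a (a + 1)) :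
    (s : UnitAddCircle) ∈ (fun s : ℝ => (s : UnitAddCircle)) '' Ioc a b ↔ s ∈ Ioc a b := by
  constructor
  · rintro ⟨s', hs', h⟩
    have := AddCircle.coe_eq_coe_iff_of_mem_Ioc (p := (1 : ℝ)) (a := a)
      ⟨hs'.1, hs'.2.trans hab⟩ hs
    rwa [← this.1 h]
  · exact fun h => ⟨s, h, rfl⟩

theorem mem_arc_iff {k : Fin l} {a b s : ℝ} (hab : b ≤ a + 1) (hs : s ∈ Ioc a (a + 1)) :
    ((k, (s : UnitAddCircle)) : Fin l × UnitAddCircle) ∈ arc k a b ↔ s ∈ Ioc a b := by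
  simp only [arc, mem_prod, mem_singleton_iff, true_and]
  exact coe_mem_image_Ioc_iff hab hs

theorem measurableSet_arc (k : Fin l) {a b : ℝ} (hab : b ≤ a + 1) : MeasurableSet (arc k a b) := by
  refine (measurableSet_singleton k).prod (measurableSet_Ioc.image_of_continuousOn_injOn
    (AddCircle.continuous_mk' 1).continuousOn fun s hs s' hs' h => ?_)
  exact (AddCircle.coe_eq_coe_iff_of_mem_Ioc (p := (1 : ℝ)) (a := a) ⟨hs.1, hs.2.trans hab⟩
    ⟨hs'.1, hs'.2.trans hab⟩).1 h

theorem logInt_indicator_arc (χ : Fin l × UnitAddCircle → ℂ) {k : Fin l} {a b : ℝ} (h : a ≤ b)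
    (hab : b ≤ a + 1) (z : ℂ) : Γ.logInt ((arc k a b).indicator χ) z =
      ∫ s in a..b, χ (k, (s : UnitAddCircle)) * Γ.kernel z (k, (s : UnitAddCircle)) := by
  classical
  unfold logInt
  rw [Finset.sum_eq_single k]
  · rw [← UnitAddCircle.intervalIntegral_preimage a, intervalIntegral.integral_of_le (by linarith),
      intervalIntegral.integral_of_le h,
      ← MeasureTheory.integral_indicator measurableSet_Ioc,
      ← MeasureTheory.integral_indicator measurableSet_Ioc]
    congr 1
    ext s
    by_cases hs : s ∈ Ioc a (a + 1)
    · rw [indicator_of_mem hs]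
      by_cases hs' : s ∈ Ioc a b
      · rw [indicator_of_mem hs', indicator_of_mem ((mem_arc_iff hab hs).2 hs')]
      · rw [indicator_of_notMem hs', indicator_of_notMem (mt (mem_arc_iff hab hs).1 hs'), zero_mul]
    · rw [indicator_of_notMem hs, indicator_of_notMem]
      exact fun hs' => hs ⟨hs'.1, hs'.2.trans hab⟩
  · intro j _ hj
    have : ∀ θ : UnitAddCircle, (arc k a b).indicator χ (j, θ) = 0 := fun θ =>
      indicator_of_notMem (fun hmem => hj hmem.1) _
    simp [this]
  · simp

/-- With `I` the integral up to the variable endpoint, `(pos - z) * exp (-I)` has derivative zero.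
Equal positions at the two ends then force `exp (-I) = 1`; velocities there need not agree, so a
loop with a corner is allowed. -/
theorem exp_integral_kernel {k : Fin l} {a b : ℝ}
    (heq : Γ.pos (k, (a : UnitAddCircle)) = Γ.pos (k, (b : UnitAddCircle))) {z : ℂ}
    (hz : z ∉ range Γ.pos) :
    Complex.exp (∫ s in a..b, Γ.kernel z (k, (s : UnitAddCircle))) = 1 := by
  have hne : ∀ q, Γ.pos q - z ≠ 0 := fun q h => hz ⟨q, sub_eq_zero.1 h⟩
  have hcont : Continuous (fun s : ℝ => Γ.kernel z (k, (s : UnitAddCircle))) :=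
    (Γ.continuous_vel_lift k).div ((Γ.continuous_pos_lift k).sub continuous_const) fun s => hne _
  set I : ℝ → ℂ := fun x => ∫ s in a..x, Γ.kernel z (k, (s : UnitAddCircle)) with hI
  have hId : ∀ x : ℝ, HasDerivAt I (Γ.kernel z (k, (x : UnitAddCircle))) x := fun x =>
    intervalIntegral.integral_hasDerivAt_right (hcont.intervalIntegrable _ _)
      (hcont.stronglyMeasurableAtFilter _ _) hcont.continuousAt
  have hFd : ∀ x : ℝ, HasDerivAt
      (fun x : ℝ => (Γ.pos (k, (x : UnitAddCircle)) - z) * Complex.exp (-I x)) 0 x := by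
    intro x
    have h1 := ((Γ.hasDerivAt k x).sub_const z).mul ((hId x).neg.cexp)
    refine HasDerivAt.congr_deriv h1 ?_
    simp only [Pi.neg_apply, kernel]
    have := hne (k, (x : UnitAddCircle))
    field_simp
    ring
  have hconst := is_const_of_deriv_eq_zero (fun x => (hFd x).differentiableAt)
    (fun x => (hFd x).deriv) a b
  simp only [hI, intervalIntegral.integral_same, neg_zero, Complex.exp_zero, mul_one] at hconst
  rw [heq] at hconst
  have h2 := (mul_right_eq_self₀.1 hconst.symm).resolve_right (hne _)
  rw [Complex.exp_neg, inv_eq_one] at h2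
  exact h2

theorem exp_logInt_arc {k : Fin l} {a b : ℝ} (h : a ≤ b) (hab : b ≤ a + 1)
    (heq : Γ.pos (k, (a : UnitAddCircle)) = Γ.pos (k, (b : UnitAddCircle))) {z : ℂ}
    (hz : z ∉ range Γ.pos) :
    Complex.exp (Γ.logInt ((arc k a b).indicator fun _ => 1) z) = 1 := by
  rw [Γ.logInt_indicator_arc _ h hab]
  simpa using Γ.exp_integral_kernel heq hz

theorem exp_logInt_one {z : ℂ} (hz : z ∉ range Γ.pos) :
    Complex.exp (Γ.logInt (fun _ => 1) z) = 1 := by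
  unfold logInt
  rw [Complex.exp_sum]
  refine Finset.prod_eq_one fun k _ => ?_
  rw [← UnitAddCircle.intervalIntegral_preimage 0]
  simp only [one_mul]
  refine Γ.exp_integral_kernel ?_ hz
  rw [zero_add, AddCircle.coe_period, AddCircle.coe_zero]

end PlanarCurves

/-! ### The integral as its pole tends to a double point -/

namespace PlanarCurves

variable {l : ℕ} (Γ : PlanarCurves l)

theorem tendsto_integral_kernel_right (k : Fin l) (s₀ : ℝ) {d : ℝ → ℂ} {d₀ : ℂ}
    (hd : Tendsto d (𝓝[>] 0) (𝓝 d₀))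
    (hs : -Γ.vel (k, (s₀ : UnitAddCircle)) / d₀ ∈ Complex.slitPlane) :
    ∀ᶠ ε in 𝓝[>] (0 : ℝ), (∀ᶠ t in 𝓝[>] (0 : ℝ), ∀ s ∈ Icc s₀ (s₀ + ε),
        Γ.pos (k, (s : UnitAddCircle)) ≠ Γ.pos (k, (s₀ : UnitAddCircle)) + t * d t) ∧
      Tendsto (fun t : ℝ => (∫ s in s₀..s₀ + ε,
          Γ.kernel (Γ.pos (k, (s₀ : UnitAddCircle)) + t * d t) (k, (s : UnitAddCircle))) +
          (Real.log t : ℂ)) (𝓝[>] 0)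
        (𝓝 (Complex.log ((Γ.pos (k, ((s₀ + ε : ℝ) : UnitAddCircle)) -
            Γ.pos (k, (s₀ : UnitAddCircle))) / Γ.vel (k, (s₀ : UnitAddCircle))) +
          Complex.log (-Γ.vel (k, (s₀ : UnitAddCircle)) / d₀))) := by
  have hv : Γ.vel (k, (s₀ : UnitAddCircle)) ≠ 0 := by
    intro h
    simp [h] at hs
  have key := tendsto_integral_inv_sub_halfBranch
    (G := fun s : ℝ => Γ.pos (k, ((s₀ + s : ℝ) : UnitAddCircle)))
    (G' := fun s : ℝ => Γ.vel (k, ((s₀ + s : ℝ) : UnitAddCircle)))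
    (fun s => (Γ.hasDerivAt k (s₀ + s)).comp_const_add s₀ s)
    ((Γ.continuous_vel_lift k).comp (continuous_const.add continuous_id))
    (by simpa using hv) hd (by simpa using hs)
  simp only [add_zero] at key
  filter_upwards [key] with ε ⟨h1, h2⟩
  constructor
  · filter_upwards [h1] with t ht s hs
    have := ht (s - s₀) ⟨by linarith [hs.1], by linarith [hs.2]⟩
    rwa [add_sub_cancel] at this
  · refine h2.congr fun t => ?_
    have := intervalIntegral.integral_comp_add_left (a := 0) (b := ε) (fun s : ℝ =>
      Γ.kernel (Γ.pos (k, (s₀ : UnitAddCircle)) + t * d t) (k, (s : UnitAddCircle))) s₀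
    rw [add_zero] at this
    rw [← this]
    rfl

/-- Reversing the parameter turns the incoming branch into an outgoing one with opposite velocity
and changes the sign of the integral, hence of `log t`. -/
theorem tendsto_integral_kernel_left (k : Fin l) (s₀ : ℝ) {d : ℝ → ℂ} {d₀ : ℂ}
    (hd : Tendsto d (𝓝[>] 0) (𝓝 d₀))
    (hs : Γ.vel (k, (s₀ : UnitAddCircle)) / d₀ ∈ Complex.slitPlane) :
    ∀ᶠ ε in 𝓝[>] (0 : ℝ), (∀ᶠ t in 𝓝[>] (0 : ℝ), ∀ s ∈ Icc (s₀ - ε) s₀,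
        Γ.pos (k, (s : UnitAddCircle)) ≠ Γ.pos (k, (s₀ : UnitAddCircle)) + t * d t) ∧
      Tendsto (fun t : ℝ => (∫ s in (s₀ - ε)..s₀,
          Γ.kernel (Γ.pos (k, (s₀ : UnitAddCircle)) + t * d t) (k, (s : UnitAddCircle))) -
          (Real.log t : ℂ)) (𝓝[>] 0)
        (𝓝 (-(Complex.log ((Γ.pos (k, ((s₀ - ε : ℝ) : UnitAddCircle)) -
            Γ.pos (k, (s₀ : UnitAddCircle))) / -Γ.vel (k, (s₀ : UnitAddCircle))) +
          Complex.log (Γ.vel (k, (s₀ : UnitAddCircle)) / d₀)))) := by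
  have hv : Γ.vel (k, (s₀ : UnitAddCircle)) ≠ 0 := by
    intro h
    simp [h] at hs
  have key := tendsto_integral_inv_sub_halfBranch
    (G := fun s : ℝ => Γ.pos (k, ((s₀ - s : ℝ) : UnitAddCircle)))
    (G' := fun s : ℝ => -Γ.vel (k, ((s₀ - s : ℝ) : UnitAddCircle)))
    (fun s => (Γ.hasDerivAt k (s₀ - s)).comp_const_sub s₀ s)
    ((Γ.continuous_vel_lift k).comp (continuous_const.sub continuous_id)).neg
    (by simpa using hv) hd (by simpa using hs)
  simp only [sub_zero, neg_neg] at key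
  filter_upwards [key] with ε ⟨h1, h2⟩
  constructor
  · filter_upwards [h1] with t ht s hs
    have := ht (s₀ - s) ⟨by linarith [hs.2], by linarith [hs.1]⟩
    rwa [sub_sub_cancel] at this
  · refine h2.neg.congr fun t => ?_
    have := intervalIntegral.integral_comp_sub_left (a := 0) (b := ε) (fun s : ℝ =>
      Γ.kernel (Γ.pos (k, (s₀ : UnitAddCircle)) + t * d t) (k, (s : UnitAddCircle))) s₀
    rw [sub_zero] at this
    rw [← this, neg_add, ← intervalIntegral.integral_neg, sub_eq_add_neg]
    congr 2
    ext s
    rw [neg_div, neg_neg]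
    rfl

/-- The constant `C` collects what depends on `ε` but not on the direction of approach. Finiteness
of `ι` lets one `ε` serve all directions. -/
theorem tendsto_integral_kernel_strand {χ : Fin l × UnitAddCircle → ℂ} (k : Fin l) (s₀ : ℝ)
    {cp cm : ℂ}
    (hp : ∀ᶠ ε in 𝓝[>] (0 : ℝ), ∀ s ∈ Ioc s₀ (s₀ + ε), χ (k, (s : UnitAddCircle)) = cp)
    (hm : ∀ᶠ ε in 𝓝[>] (0 : ℝ), ∀ s ∈ Ioc (s₀ - ε) s₀, χ (k, (s : UnitAddCircle)) = cm)
    {ι : Type*} [Finite ι] {d : ι → ℝ → ℂ} {d₀ : ι → ℂ}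
    (hd : ∀ i, Tendsto (d i) (𝓝[>] 0) (𝓝 (d₀ i)))
    (hs₁ : ∀ i, -Γ.vel (k, (s₀ : UnitAddCircle)) / d₀ i ∈ Complex.slitPlane)
    (hs₂ : ∀ i, Γ.vel (k, (s₀ : UnitAddCircle)) / d₀ i ∈ Complex.slitPlane) :
    ∀ᶠ ε in 𝓝[>] (0 : ℝ), ∃ C : ℂ, ∀ i,
      (∀ᶠ t in 𝓝[>] (0 : ℝ), ∀ s ∈ Icc (s₀ - ε) (s₀ + ε),
        Γ.pos (k, (s : UnitAddCircle)) ≠ Γ.pos (k, (s₀ : UnitAddCircle)) + t * d i t) ∧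
      Tendsto (fun t : ℝ => (∫ s in (s₀ - ε)..(s₀ + ε), χ (k, (s : UnitAddCircle)) *
          Γ.kernel (Γ.pos (k, (s₀ : UnitAddCircle)) + t * d i t) (k, (s : UnitAddCircle))) +
          (cp - cm) * (Real.log t : ℂ)) (𝓝[>] 0)
        (𝓝 (C + (cp * Complex.log (-Γ.vel (k, (s₀ : UnitAddCircle)) / d₀ i) -
          cm * Complex.log (Γ.vel (k, (s₀ : UnitAddCircle)) / d₀ i)))) := by
  have hr := eventually_all.2 fun i => Γ.tendsto_integral_kernel_right k s₀ (hd i) (hs₁ i)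
  have hl := eventually_all.2 fun i => Γ.tendsto_integral_kernel_left k s₀ (hd i) (hs₂ i)
  filter_upwards [hr, hl, hp, hm, self_mem_nhdsWithin] with ε hr hl hp hm (hε : 0 < ε)
  set e := Γ.vel (k, (s₀ : UnitAddCircle)) with he
  set z₀ := Γ.pos (k, (s₀ : UnitAddCircle)) with hz₀
  refine ⟨cp * Complex.log ((Γ.pos (k, ((s₀ + ε : ℝ) : UnitAddCircle)) - z₀) / e) -
    cm * Complex.log ((Γ.pos (k, ((s₀ - ε : ℝ) : UnitAddCircle)) - z₀) / -e), fun i => ?_⟩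
  have hne : ∀ᶠ t in 𝓝[>] (0 : ℝ), ∀ s ∈ Icc (s₀ - ε) (s₀ + ε),
        Γ.pos (k, (s : UnitAddCircle)) ≠ z₀ + t * d i t := by
    filter_upwards [(hr i).1, (hl i).1] with t h1 h2 s hs
    rcases le_total s s₀ with h | h
    · exact h2 s ⟨hs.1, h⟩
    · exact h1 s ⟨h, hs.2⟩
  refine ⟨hne, ?_⟩
  have hlim := ((hr i).2.const_mul cp).add ((hl i).2.const_mul cm)
  refine Tendsto.congr' ?_ (hlim.mono_right (le_of_eq (congrArg 𝓝 ?_)))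
  · filter_upwards [hne] with t ht
    set z := z₀ + t * d i t with hz
    have hcont : ContinuousOn (fun s : ℝ => Γ.kernel z (k, (s : UnitAddCircle)))
        (Icc (s₀ - ε) (s₀ + ε)) :=
      (Γ.continuous_vel_lift k).continuousOn.div
        ((Γ.continuous_pos_lift k).sub continuous_const).continuousOn
        fun s hs => sub_ne_zero.2 (ht s hs)
    have hi1 : IntervalIntegrable (fun s : ℝ => cp * Γ.kernel z (k, (s : UnitAddCircle)))
        MeasureTheory.volume s₀ (s₀ + ε) := by
      refine ContinuousOn.intervalIntegrable (continuousOn_const.mul (hcont.mono ?_))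
      rw [uIcc_of_le (by linarith)]
      exact Icc_subset_Icc_left (by linarith)
    have hi2 : IntervalIntegrable (fun s : ℝ => cm * Γ.kernel z (k, (s : UnitAddCircle)))
        MeasureTheory.volume (s₀ - ε) s₀ := by
      refine ContinuousOn.intervalIntegrable (continuousOn_const.mul (hcont.mono ?_))
      rw [uIcc_of_le (by linarith)]
      exact Icc_subset_Icc_right (by linarith)
    have he1 : EqOn (fun s : ℝ => cp * Γ.kernel z (k, (s : UnitAddCircle)))
        (fun s : ℝ => χ (k, (s : UnitAddCircle)) * Γ.kernel z (k, (s : UnitAddCircle)))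
        (uIoc s₀ (s₀ + ε)) := by
      intro s hs
      rw [uIoc_of_le (by linarith)] at hs
      simp only [hp s hs]
    have he2 : EqOn (fun s : ℝ => cm * Γ.kernel z (k, (s : UnitAddCircle)))
        (fun s : ℝ => χ (k, (s : UnitAddCircle)) * Γ.kernel z (k, (s : UnitAddCircle)))
        (uIoc (s₀ - ε) s₀) := by
      intro s hs
      rw [uIoc_of_le (by linarith)] at hs
      simp only [hm s hs]
    rw [← intervalIntegral.integral_add_adjacent_intervals (hi2.congr he2) (hi1.congr he1),
      ← intervalIntegral.integral_congr_ae (Eventually.of_forall he1),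
      ← intervalIntegral.integral_congr_ae (Eventually.of_forall he2),
      intervalIntegral.integral_const_mul, intervalIntegral.integral_const_mul]
    ring
  · ring

theorem eventually_arc_subset {k : Fin l} {s : ℝ} {U : Set (Fin l × UnitAddCircle)}
    (hU : U ∈ 𝓝 ((k, (s : UnitAddCircle)) : Fin l × UnitAddCircle)) :
    ∀ᶠ ε in 𝓝[>] (0 : ℝ), arc k (s - ε) (s + ε) ⊆ U := by
  have hc : Continuous (fun s : ℝ => ((k, (s : UnitAddCircle)) : Fin l × UnitAddCircle)) :=
    continuous_const.prodMk (AddCircle.continuous_mk' 1)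
  obtain ⟨δ, hδ, h⟩ := Metric.mem_nhds_iff.1 (hc.continuousAt (x := s) hU)
  filter_upwards [Ioo_mem_nhdsGT hδ] with ε hε
  rintro ⟨k', θ⟩ ⟨rfl, s', hs', rfl⟩
  refine h ?_
  rw [Metric.mem_ball, Real.dist_eq, abs_lt]
  constructor <;> linarith [hs'.1, hs'.2, hε.2]

theorem arc_mem_nhds {k : Fin l} {s ε : ℝ} (hε : 0 < ε) :
    arc k (s - ε) (s + ε) ∈ 𝓝 ((k, (s : UnitAddCircle)) : Fin l × UnitAddCircle) := by
  refine prod_mem_nhds (by simp) ?_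
  exact (QuotientAddGroup.isOpenMap_coe (N := AddSubgroup.zmultiples (1 : ℝ))).image_mem_nhds
    (Ioc_mem_nhds (by linarith) (by linarith))

/-- The behaviour of a weighted logarithmic integral when the pole approaches a double point of
the curves along finitely many curves transverse to both strands. -/
theorem tendsto_logInt_doublePoint {χ : Fin l × UnitAddCircle → ℂ} (hχ : IsWeight χ)
    {k : Fin 2 → Fin l} {s₀ : Fin 2 → ℝ} {z₀ : ℂ}
    (hne : ((k 0, (s₀ 0 : UnitAddCircle)) : Fin l × UnitAddCircle) ≠ (k 1, (s₀ 1 : UnitAddCircle)))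
    (hz₀ : ∀ j, Γ.pos (k j, (s₀ j : UnitAddCircle)) = z₀)
    (hz : ∀ q, Γ.pos q = z₀ → ∃ j, q = (k j, (s₀ j : UnitAddCircle)))
    {cp cm : Fin 2 → ℂ}
    (hp : ∀ j, ∀ᶠ ε in 𝓝[>] (0 : ℝ), ∀ s ∈ Ioc (s₀ j) (s₀ j + ε),
      χ (k j, (s : UnitAddCircle)) = cp j)
    (hm : ∀ j, ∀ᶠ ε in 𝓝[>] (0 : ℝ), ∀ s ∈ Ioc (s₀ j - ε) (s₀ j),
      χ (k j, (s : UnitAddCircle)) = cm j)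
    {ι : Type*} [Finite ι] {p : ι → ℝ → ℂ} {d : ι → ℝ → ℂ} {d₀ : ι → ℂ}
    (hpd : ∀ i t, 0 < t → p i t = z₀ + t * d i t)
    (hd : ∀ i, Tendsto (d i) (𝓝[>] 0) (𝓝 (d₀ i)))
    (hs : ∀ i j, (Γ.vel (k j, (s₀ j : UnitAddCircle)) / d₀ i).im ≠ 0) :
    ∃ C : ℂ, ∀ i, (∀ᶠ t in 𝓝[>] (0 : ℝ), p i t ∉ range Γ.pos) ∧
      Tendsto (fun t : ℝ => Γ.logInt χ (p i t) + (∑ j, (cp j - cm j)) * (Real.log t : ℂ)) (𝓝[>] 0)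
        (𝓝 (C + ∑ j, (cp j * Complex.log (-Γ.vel (k j, (s₀ j : UnitAddCircle)) / d₀ i) -
          cm j * Complex.log (Γ.vel (k j, (s₀ j : UnitAddCircle)) / d₀ i)))) := by
  have hstrand := eventually_all.2 fun j => Γ.tendsto_integral_kernel_strand (k j) (s₀ j) (hp j)
    (hm j) hd (fun i => Or.inr (by rw [neg_div, Complex.neg_im]; exact neg_ne_zero.2 (hs i j)))
    (fun i => Or.inr (hs i j))
  obtain ⟨U₀, U₁, hU₀, hU₁, hm₀, hm₁, hdisj⟩ := t2_separation hne
  have hsub₀ := eventually_arc_subset (hU₀.mem_nhds hm₀)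
  have hsub₁ := eventually_arc_subset (hU₁.mem_nhds hm₁)
  -- The bound `1 / 2` keeps the arcs of length `2 * ε` within one turn of the circle; the
  -- separating neighbourhoods keep the two arcs disjoint.
  obtain ⟨ε, hst, hsub₀, hsub₁, hε⟩ :=
    (hstrand.and (hsub₀.and (hsub₁.and (Ioo_mem_nhdsGT (show (0 : ℝ) < 1 / 2 by norm_num))))).exists
  choose C hC using hst
  simp only [hz₀] at hC
  set N : Fin 2 → Set (Fin l × UnitAddCircle) := fun j => arc (k j) (s₀ j - ε) (s₀ j + ε) with hN
  have hNm : ∀ j, MeasurableSet (N j) := fun j => measurableSet_arc _ (by linarith [hε.2])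
  have hNd : Disjoint (N 0) (N 1) := hdisj.mono hsub₀ hsub₁
  set F := (N 0 ∪ N 1)ᶜ with hF
  obtain ⟨δ, hδ, hfar⟩ : ∃ δ > 0, ∀ q ∈ F, δ ≤ ‖Γ.pos q - z₀‖ := by
    -- The arcs are half-open; removing only their interiors leaves a compact set, on which the
    -- distance to `z₀` attains a positive minimum.
    set K := (interior (N 0) ∪ interior (N 1))ᶜ with hK
    have hKc : IsCompact K := (isOpen_interior.union isOpen_interior).isClosed_compl.isCompact
    have hFK : F ⊆ K := compl_subset_compl.2 (union_subset_union interior_subset interior_subset)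
    rcases K.eq_empty_or_nonempty with h | h
    · exact ⟨1, one_pos, fun q hq => by simpa [h] using hFK hq⟩
    · obtain ⟨q₀, hq₀, hmin⟩ := hKc.exists_isMinOn h
        ((Γ.continuous_pos.sub continuous_const).norm (f := fun q => Γ.pos q - z₀)).continuousOn
      refine ⟨‖Γ.pos q₀ - z₀‖, ?_, fun q hq => hmin (hFK hq)⟩
      rw [gt_iff_lt, norm_pos_iff]
      intro h0
      obtain ⟨j, hj⟩ := hz q₀ (sub_eq_zero.1 h0)
      have hjN : q₀ ∈ interior (N j) := by
        rw [hj]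
        exact mem_interior_iff_mem_nhds.2 (arc_mem_nhds hε.1)
      fin_cases j
      · exact hq₀ (Or.inl hjN)
      · exact hq₀ (Or.inr hjN)
  have hpz : ∀ i, Tendsto (p i) (𝓝[>] 0) (𝓝 z₀) := by
    intro i
    have ht0 : Tendsto (fun t : ℝ => (t : ℂ)) (𝓝[>] 0) (𝓝 0) := by
      have : Tendsto (fun t : ℝ => (t : ℂ)) (𝓝 0) (𝓝 ((0 : ℝ) : ℂ)) :=
        Complex.continuous_ofReal.tendsto 0
      simpa using this.mono_left nhdsWithin_le_nhds
    have h1 : Tendsto (fun t : ℝ => z₀ + t * d i t) (𝓝[>] 0) (𝓝 z₀) := by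
      simpa using tendsto_const_nhds.add (ht0.mul (hd i))
    refine h1.congr' ?_
    filter_upwards [self_mem_nhdsWithin] with t ht
    exact (hpd i t ht).symm
  have hcontF : ContinuousAt (Γ.logInt (F.indicator χ)) z₀ := by
    refine Γ.continuousAt_logInt
      (hχ.indicator ((hNm 0).union (hNm 1)).compl) hδ fun q hq => hfar q ?_
    by_contra hcon
    exact hq (indicator_of_notMem hcon _)
  refine ⟨Γ.logInt (F.indicator χ) z₀ + C 0 + C 1, fun i => ?_⟩
  have hnr : ∀ᶠ t in 𝓝[>] (0 : ℝ), p i t ∉ range Γ.pos := by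
    have hclose := (hpz i).eventually (Metric.ball_mem_nhds z₀ hδ)
    filter_upwards [(hC 0 i).1, (hC 1 i).1, hclose, self_mem_nhdsWithin] with t h0 h1 hcl ht
    rintro ⟨q, hq⟩
    rw [hpd i t ht] at hq
    by_cases hq0 : q ∈ N 0
    · obtain ⟨k', θ⟩ := q
      obtain ⟨rfl, s, hs, rfl⟩ := hq0
      exact h0 s (Ioc_subset_Icc_self hs) hq
    · by_cases hq1 : q ∈ N 1
      · obtain ⟨k', θ⟩ := q
        obtain ⟨rfl, s, hs, rfl⟩ := hq1
        exact h1 s (Ioc_subset_Icc_self hs) hq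
      · have := hfar q (by rintro (h | h); exacts [hq0 h, hq1 h])
        rw [hq, ← hpd i t ht, ← dist_eq_norm] at this
        exact absurd hcl (not_lt.2 this)
  refine ⟨hnr, ?_⟩
  have hlim := ((hcontF.tendsto.comp (hpz i)).add (hC 0 i).2).add (hC 1 i).2
  refine Tendsto.congr' ?_ (hlim.mono_right (le_of_eq (congrArg 𝓝 ?_)))
  · filter_upwards [hnr, self_mem_nhdsWithin] with t ht htpos
    have hadd : Γ.logInt χ (p i t) = Γ.logInt ((N 0).indicator χ) (p i t) +
        (Γ.logInt ((N 1).indicator χ) (p i t) + Γ.logInt (F.indicator χ) (p i t)) := by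
      rw [← Γ.logInt_indicator_add_compl hχ (hNm 0) ht,
        ← Γ.logInt_indicator_add_compl (hχ.indicator (hNm 0).compl) (hNm 1) ht,
        indicator_indicator, indicator_indicator,
        inter_eq_left.2 (subset_compl_iff_disjoint_left.2 hNd), hF, compl_union, inter_comm]
    rw [hadd, Γ.logInt_indicator_arc χ (by linarith [hε.1]) (by linarith [hε.2]),
      Γ.logInt_indicator_arc χ (by linarith [hε.1]) (by linarith [hε.2]), Fin.sum_univ_two]
    simp only [Function.comp, hpd i t htpos]
    ring
  · rw [Fin.sum_univ_two]
    ring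

end PlanarCurves

/-! ### Arguments of the strands seen from the four corners -/

namespace PlanarCurves

open scoped ComplexConjugate

/-- The direction `σ u + τ o` inside the corner `(σ, τ)` between two lines. -/
noncomputable def cornerDir (u o : ℂ) (κ : ℤˣ × ℤˣ) : ℂ :=
  ((κ.1 : ℤ) : ℂ) * u + ((κ.2 : ℤ) : ℂ) * o

/-- The sign of this imaginary part tells on which side of the line of `u` the corner lies, and it
depends on the corner only through `κ.2`. -/
theorem im_div_cornerDir_left (u o : ℂ) (κ : ℤˣ × ℤˣ) : (u / cornerDir u o κ).im =
    ((κ.2 : ℤ) : ℝ) * (u * conj o).im / Complex.normSq (cornerDir u o κ) := by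
  rw [Complex.div_im, ← sub_div]
  congr 1
  simp [cornerDir]
  ring

theorem im_div_cornerDir_right (u o : ℂ) (κ : ℤˣ × ℤˣ) : (o / cornerDir u o κ).im =
    -((κ.1 : ℤ) : ℝ) * (u * conj o).im / Complex.normSq (cornerDir u o κ) := by
  rw [Complex.div_im, ← sub_div]
  congr 1
  simp [cornerDir]
  ring

theorem cornerDir_neg (u o : ℂ) (κ : ℤˣ × ℤˣ) : cornerDir u o (-κ) = -cornerDir u o κ := by
  simp [cornerDir]
  ring

theorem intUnit_ne_zero (σ : ℤˣ) : ((σ : ℤ) : ℝ) ≠ 0 := by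
  exact_mod_cast σ.ne_zero

theorem normSq_cornerDir_pos {u o : ℂ} (h : (u * conj o).im ≠ 0) (κ : ℤˣ × ℤˣ) :
    0 < Complex.normSq (cornerDir u o κ) := by
  rw [Complex.normSq_pos]
  intro h0
  apply h
  have h1 : u = -(((κ.1 : ℤ) : ℝ) * ((κ.2 : ℤ) : ℝ) : ℝ) * o := by
    have h2 : ((κ.1 : ℤ) : ℂ) * ((κ.1 : ℤ) : ℂ) = 1 := by
      have := Int.units_coe_mul_self κ.1
      exact_mod_cast this
    unfold cornerDir at h0
    push_cast
    linear_combination ((κ.1 : ℤ) : ℂ) * h0 - u * h2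
  rw [h1, mul_assoc, Complex.mul_conj, ← Complex.ofReal_neg, ← Complex.ofReal_mul,
    Complex.ofReal_im]

theorem log_neg_sub_log {z : ℂ} {s : ℝ} (hs : s = 1 ∨ s = -1) (hz : 0 < s * z.im) :
    Complex.log (-z) - Complex.log z = -(Real.pi * s * Complex.I) := by
  rcases hs with rfl | rfl
  · rw [one_mul] at hz
    simp only [Complex.log, norm_neg, Complex.arg_neg_eq_arg_sub_pi_of_im_pos hz]
    push_cast
    ring
  · have hz' : z.im < 0 := by linarith
    simp only [Complex.log, norm_neg, Complex.arg_neg_eq_arg_add_pi_of_im_neg hz']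
    push_cast
    ring

/-- A strand carrying the same weight on both halves contributes `±πi` according to the side on
which the corner lies. For the underpass this side is `κ.2`, for the overpass, in
`log_sub_log_right`, it is `κ.1`. -/
theorem log_sub_log_left {u o : ℂ} {s : ℝ} (hs : s = 1 ∨ s = -1) (h : 0 < s * (u * conj o).im)
    (κ : ℤˣ × ℤˣ) :
    Complex.log (-u / cornerDir u o κ) - Complex.log (u / cornerDir u o κ) =
      -(Real.pi * s * ((κ.2 : ℤ) : ℂ) * Complex.I) := by
  have hpos := normSq_cornerDir_pos (right_ne_zero_of_mul h.ne') κ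
  have key := log_neg_sub_log (z := u / cornerDir u o κ) (s := s * ((κ.2 : ℤ) : ℝ)) ?_ ?_
  · rw [neg_div, key]
    push_cast
    ring
  · rcases Int.units_eq_one_or κ.2 with h2 | h2 <;> rcases hs with rfl | rfl <;> simp [h2]
  · rw [im_div_cornerDir_left]
    have h2 : ((κ.2 : ℤ) : ℝ) * ((κ.2 : ℤ) : ℝ) = 1 := by
      exact_mod_cast Int.units_coe_mul_self κ.2
    have : s * ((κ.2 : ℤ) : ℝ) * (((κ.2 : ℤ) : ℝ) * (u * conj o).im /
        Complex.normSq (cornerDir u o κ)) =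
        s * (u * conj o).im / Complex.normSq (cornerDir u o κ) := by
      linear_combination (s * (u * conj o).im / Complex.normSq (cornerDir u o κ)) * h2
    rw [this]
    positivity

theorem log_sub_log_right {u o : ℂ} {s : ℝ} (hs : s = 1 ∨ s = -1) (h : 0 < s * (u * conj o).im)
    (κ : ℤˣ × ℤˣ) :
    Complex.log (-o / cornerDir u o κ) - Complex.log (o / cornerDir u o κ) =
      Real.pi * s * ((κ.1 : ℤ) : ℂ) * Complex.I := by
  have hpos := normSq_cornerDir_pos (right_ne_zero_of_mul h.ne') κ
  have key := log_neg_sub_log (z := o / cornerDir u o κ) (s := -s * ((κ.1 : ℤ) : ℝ)) ?_ ?_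
  · rw [neg_div, key]
    push_cast
    ring
  · rcases Int.units_eq_one_or κ.1 with h2 | h2 <;> rcases hs with rfl | rfl <;> simp [h2]
  · rw [im_div_cornerDir_right]
    have h2 : ((κ.1 : ℤ) : ℝ) * ((κ.1 : ℤ) : ℝ) = 1 := by
      exact_mod_cast Int.units_coe_mul_self κ.1
    have : -s * ((κ.1 : ℤ) : ℝ) * (-((κ.1 : ℤ) : ℝ) * (u * conj o).im /
        Complex.normSq (cornerDir u o κ)) =
        s * (u * conj o).im / Complex.normSq (cornerDir u o κ) := by
      linear_combination (s * (u * conj o).im / Complex.normSq (cornerDir u o κ)) * h2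
    rw [this]
    positivity

theorem eq_of_exp_eq_of_abs_im_sub_lt {a b : ℂ} (h : Complex.exp a = Complex.exp b)
    (h' : |a.im - b.im| < 2 * Real.pi) : a = b := by
  obtain ⟨n, hn⟩ := Complex.exp_eq_exp_iff_exists_int.1 h
  have him : a.im - b.im = n * (2 * Real.pi) := by
    rw [hn]
    simp
  rw [him, abs_mul, abs_of_pos Real.two_pi_pos, mul_lt_iff_lt_one_left Real.two_pi_pos] at h'
  have : n = 0 := by
    rw [← Int.abs_lt_one_iff]
    exact_mod_cast h'
  simpa [this] using hn

/-- Both sides have the same exponential. Since `o / cornerDir u o (1, τ)` and `o / u` lie in the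
same open half plane, their arguments have the same sign, the imaginary parts differ by less than
`2π`, and no multiple of `2πi` intervenes. The point is that the right side does not depend on `τ`.
-/
theorem log_div_sub_log_div {u o : ℂ} (h : (u * conj o).im ≠ 0) (τ : ℤˣ) :
    Complex.log (o / cornerDir u o (1, τ)) - Complex.log (u / cornerDir u o (1, τ)) =
      Complex.log (o / u) := by
  have hpos := normSq_cornerDir_pos h (1, τ)
  have hd : cornerDir u o (1, τ) ≠ 0 := Complex.normSq_pos.1 hpos
  have hu : u ≠ 0 := by
    rintro rfl
    simp at h
  have ho : o ≠ 0 := by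
    rintro rfl
    simp at h
  apply eq_of_exp_eq_of_abs_im_sub_lt
  · rw [Complex.exp_sub, Complex.exp_log (div_ne_zero ho hd), Complex.exp_log (div_ne_zero hu hd),
      Complex.exp_log (div_ne_zero ho hu), div_div_div_cancel_right₀ hd]
  · rw [Complex.sub_im, Complex.log_im, Complex.log_im, Complex.log_im]
    have hsq := Complex.normSq_pos.2 hu
    have him3 : (o / u).im = -(u * conj o).im / Complex.normSq u := by
      rw [Complex.div_im, ← sub_div]
      congr 1
      simp
      ring
    have him1 := im_div_cornerDir_right u o (1, τ)
    have hle := fun z : ℂ => Complex.arg_le_pi z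
    have hgt := fun z : ℂ => Complex.neg_pi_lt_arg z
    have hlt : ∀ z : ℂ, z.im ≠ 0 → Complex.arg z < Real.pi := fun z hz =>
      lt_of_le_of_ne (hle z) (Complex.mem_slitPlane_iff_arg.1 (Or.inr hz)).1
    have him2 : (u / cornerDir u o (1, τ)).im ≠ 0 := by
      rw [im_div_cornerDir_left]
      exact div_ne_zero (mul_ne_zero (intUnit_ne_zero τ) h) hpos.ne'
    have a1 := hgt (o / cornerDir u o (1, τ))
    have a2 := hgt (u / cornerDir u o (1, τ))
    have a3 := hgt (o / u)
    have a5 := hlt _ him2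
    rcases lt_or_gt_of_ne h with hX | hX
    · have b1 : 0 < (o / cornerDir u o (1, τ)).im := by
        rw [him1]
        refine div_pos ?_ hpos
        simpa using hX
      have b3 : 0 < (o / u).im := by
        rw [him3]
        exact div_pos (by linarith) hsq
      have c1 := Complex.arg_nonneg_iff.2 b1.le
      have c3 := Complex.arg_nonneg_iff.2 b3.le
      have a4 := hlt _ b1.ne'
      have a6 := hlt _ b3.ne'
      rw [abs_lt]
      constructor <;> linarith
    · have b1 : (o / cornerDir u o (1, τ)).im < 0 := by
        rw [him1]
        refine div_neg_of_neg_of_pos ?_ hpos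
        simpa using hX
      have b3 : (o / u).im < 0 := by
        rw [him3]
        exact div_neg_of_neg_of_pos (by linarith) hsq
      have c1 := Complex.arg_neg_iff.2 b1
      have c3 := Complex.arg_neg_iff.2 b3
      rw [abs_lt]
      constructor <;> linarith

/-- The alternating sum of a function over the four corners. -/
def altSum {R : Type*} [AddCommGroup R] (f : ℤˣ × ℤˣ → R) : R :=
  f (1, 1) + f (-1, -1) - f (1, -1) - f (-1, 1)

/-- This is the contribution of a loop arriving along the underpass and leaving along the overpass.
Passing to opposite corners changes the sign of the direction, so all eight logarithms reduce to the
corners `(1, 1)` and `(1, -1)`. There `log_div_sub_log_div` cancels everything but half turns. -/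
theorem altSum_turn {u o : ℂ} {s : ℝ} (hs : s = 1 ∨ s = -1) (h : 0 < s * (u * conj o).im) :
    altSum (fun κ => Complex.log (-o / cornerDir u o κ) - Complex.log (u / cornerDir u o κ)) =
      2 * Real.pi * s * Complex.I := by
  have hX : (u * conj o).im ≠ 0 := right_ne_zero_of_mul h.ne'
  have r := fun κ => log_sub_log_right hs h κ
  have e := fun κ => log_sub_log_left hs h κ
  have n1 : cornerDir u o (-1, -1) = -cornerDir u o (1, 1) := cornerDir_neg u o (1, 1)
  have n2 : cornerDir u o (-1, 1) = -cornerDir u o (1, -1) := by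
    simpa using cornerDir_neg u o (1, -1)
  have l1 := log_div_sub_log_div hX 1
  have l2 := log_div_sub_log_div hX (-1)
  have r1 := r (1, 1)
  have r2 := r (1, -1)
  have e1 := e (1, 1)
  have e2 := e (1, -1)
  simp only [altSum, n1, n2, neg_div_neg_eq]
  simp only [div_neg, neg_div] at *
  push_cast at *
  linear_combination 2 * l1 - 2 * l2 + r1 - e1 - r2 + e2

end PlanarCurves

/-! ### Tangent directions on the plane and the sphere -/

namespace DiagramSurface

theorem inner_normal_deriv (S : DiagramSurface) {γ : ℝ → E3} {w : E3} {t : ℝ}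
    (hγ : HasDerivAt γ w t) (hS : ∀ s, γ s ∈ S.carrier) : inner ℝ (S.normal (γ t)) w = 0 := by
  cases S with
  | plane =>
    have h1 : HasDerivAt (fun s => γ s 2) (w 2) t :=
      ((EuclideanSpace.proj (𝕜 := ℝ) (2 : Fin 3)).hasFDerivAt.comp_hasDerivAt t hγ)
    have h2 : (fun s => γ s 2) = fun _ => 0 := funext fun s => hS s
    rw [h2] at h1
    simpa [normal, EuclideanSpace.inner_single_left] using h1.unique (hasDerivAt_const t (0 : ℝ))
  | sphere =>
    have h1 := hγ.norm_sq
    have h2 : (fun s => ‖γ s‖ ^ 2) = fun _ => 1 := funext fun s => by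
      have : ‖γ s‖ = 1 := by simpa [carrier] using hS s
      simp [this]
    rw [h2] at h1
    simpa [normal] using h1.unique (hasDerivAt_const t (1 : ℝ))

theorem add_smul_ne_zero {p w : E3} (hp : ‖p‖ = 1) (hw : inner ℝ p w = 0) (t : ℝ) :
    p + t • w ≠ 0 := by
  intro h
  have : inner ℝ p (p + t • w) = (1 : ℝ) := by
    rw [inner_add_right, inner_smul_right, hw, real_inner_self_eq_norm_sq, hp]
    norm_num
  rw [h, inner_zero_right] at this
  exact zero_ne_one this

theorem retract_mem (S : DiagramSurface) {p w : E3} (hp : p ∈ S.carrier)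
    (hw : inner ℝ (S.normal p) w = 0) (t : ℝ) : S.retract (p + t • w) ∈ S.carrier := by
  cases S with
  | plane => simp [retract, carrier]
  | sphere =>
    have := add_smul_ne_zero (p := p) (by simpa [carrier] using hp) hw t
    simp only [retract, carrier, mem_sphere_zero_iff_norm, norm_smul, norm_inv, norm_norm]
    exact inv_mul_cancel₀ (norm_ne_zero_iff.2 this)

theorem retract_zero (S : DiagramSurface) {p : E3} (hp : p ∈ S.carrier) : S.retract p = p := by
  cases S with
  | plane =>
    have : p 2 = 0 := hp
    simp [retract, this]
  | sphere =>
    have : ‖p‖ = 1 := by simpa [carrier] using hp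
    simp [retract, this]

theorem continuous_retract_line (S : DiagramSurface) {p w : E3} (hp : p ∈ S.carrier)
    (hw : inner ℝ (S.normal p) w = 0) : Continuous fun t : ℝ => S.retract (p + t • w) := by
  have hl : Continuous fun t : ℝ => p + t • w := by fun_prop
  cases S with
  | plane =>
    simp only [retract]
    fun_prop
  | sphere =>
    have := add_smul_ne_zero (p := p) (by simpa [carrier] using hp) hw
    exact (hl.norm.inv₀ fun t => norm_ne_zero_iff.2 (this t)).smul hl

theorem hasDerivAt_retract_line (S : DiagramSurface) {p w : E3} (hp : p ∈ S.carrier)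
    (hw : inner ℝ (S.normal p) w = 0) : HasDerivAt (fun t : ℝ => S.retract (p + t • w)) w 0 := by
  have hl : HasDerivAt (fun t : ℝ => p + t • w) w 0 := by
    simpa using ((hasDerivAt_id (0 : ℝ)).smul_const w).const_add p
  cases S with
  | plane =>
    have h1 : w 2 = 0 := by simpa [normal, EuclideanSpace.inner_single_left] using hw
    have h2 : p 2 = 0 := hp
    have : (fun t : ℝ => retract plane (p + t • w)) = fun t : ℝ => p + t • w := by
      funext t
      simp [retract, h1, h2]
    rwa [this]
  | sphere =>
    have hp1 : ‖p‖ = 1 := by simpa [carrier] using hp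
    have h1 := hl.norm_sq
    -- Since `w` is orthogonal to `p`, the norm is stationary and normalisation does not change the
    -- velocity.
    have h2 : HasDerivAt (fun t : ℝ => ‖p + t • w‖) 0 0 := by
      have h3 := h1.sqrt (by simp [hp1])
      simp only [zero_smul, add_zero] at h3
      rw [show inner ℝ p w = (0 : ℝ) from hw] at h3
      simpa using h3
    have h4 := (h2.inv (by simp [hp1])).smul hl
    refine HasDerivAt.congr_deriv h4 ?_
    simp [hp1]

theorem norm_normal (S : DiagramSurface) {p : E3} (hp : p ∈ S.carrier) : ‖S.normal p‖ = 1 := by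
  cases S with
  | plane => simp [normal]
  | sphere => simpa [normal, carrier] using hp

theorem area_smul_smul (S : DiagramSurface) (p u v : E3) (a b : ℤ) :
    S.area p (a • u) (b • v) = (a * b : ℤ) * S.area p u v := by
  simp [area, Matrix.det_fin_three]
  ring

theorem area_ne_zero (S : DiagramSurface) {p u v : E3} (hp : p ∈ S.carrier)
    (hu : inner ℝ (S.normal p) u = 0) (hv : inner ℝ (S.normal p) v = 0)
    (huv : LinearIndependent ℝ ![u, v]) : S.area p u v ≠ 0 := by
  intro h
  obtain ⟨c, hc, hc0⟩ := Matrix.exists_vecMul_eq_zero_iff.2 h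
  apply hc
  have hsum : c 0 • S.normal p + c 1 • u + c 2 • v = 0 := by
    ext j
    have := congrFun hc0 j
    simpa [Matrix.vecMul, dotProduct, Fin.sum_univ_three] using this
  have h0 : c 0 = 0 := by
    have := congrArg (inner ℝ (S.normal p)) hsum
    simpa [inner_add_right, inner_smul_right, hu, hv, S.norm_normal hp] using this
  rw [h0, zero_smul, zero_add] at hsum
  obtain ⟨h1, h2⟩ := LinearIndependent.pair_iff.1 huv _ _ hsum
  funext j
  fin_cases j
  · exact h0
  · exact h1
  · exact h2

/-! ### Planar charts and stereographic projection -/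

/-- A smooth coordinate with values in the complex plane on the complement of a finite set of
poles, all of which are sent to infinity. -/
structure PlaneChart (S : DiagramSurface) where
  toFun : E3 → ℂ
  pole : Set E3
  finite_pole : pole.Finite
  injOn : InjOn toFun (S.carrier \ pole)
  contDiffAt : ∀ p ∈ S.carrier \ pole, ContDiffAt ℝ 1 toFun p
  tendsto_pole : ∀ p ∈ pole, Tendsto toFun (𝓝[S.carrier \ pole] p) (cocompact ℂ)
  ker_fderiv : ∀ p ∈ S.carrier \ pole, ∀ w : E3, inner ℝ (S.normal p) w = 0 →
    fderiv ℝ toFun p w = 0 → w = 0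

/-- The coordinate plane as the complex plane. -/
noncomputable def planeCoord : E3 →L[ℝ] ℂ :=
  (EuclideanSpace.proj (𝕜 := ℝ) (0 : Fin 3)).smulRight (1 : ℂ) +
    (EuclideanSpace.proj (𝕜 := ℝ) (1 : Fin 3)).smulRight Complex.I

theorem planeCoord_re (p : E3) : (planeCoord p).re = p 0 := by simp [planeCoord]

theorem planeCoord_im (p : E3) : (planeCoord p).im = p 1 := by simp [planeCoord]

theorem E3.ext_coord {p q : E3} (h0 : p 0 = q 0) (h1 : p 1 = q 1) (h2 : p 2 = q 2) : p = q := by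
  ext j
  fin_cases j
  · exact h0
  · exact h1
  · exact h2

/-- The tautological chart of the plane. -/
noncomputable def planeChart : PlaneChart plane where
  toFun := planeCoord
  pole := ∅
  finite_pole := finite_empty
  injOn := by
    rintro p ⟨hp, -⟩ q ⟨hq, -⟩ h
    refine E3.ext_coord ?_ ?_ ?_
    · rw [← planeCoord_re, h, planeCoord_re]
    · rw [← planeCoord_im, h, planeCoord_im]
    · exact Eq.trans hp (Eq.symm hq)
  contDiffAt p _ := planeCoord.contDiff.contDiffAt
  tendsto_pole := by simp
  ker_fderiv p _ w hw h := by
    rw [planeCoord.fderiv] at h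
    have h2 : w 2 = 0 := by simpa [normal, EuclideanSpace.inner_single_left] using hw
    refine E3.ext_coord ?_ ?_ h2
    · rw [← planeCoord_re, h]; rfl
    · rw [← planeCoord_im, h]; rfl

section Stereographic

variable (A : E3 ≃ₗᵢ[ℝ] E3)

/-- Stereographic projection from the point whose image under the isometry `A` is the north
pole. -/
noncomputable def stereo (p : E3) : ℂ := planeCoord (A p) / ((1 - A p 2 : ℝ) : ℂ)

theorem sq_add_sq_add_sq {p : E3} (hp : p ∈ sphere.carrier) :
    A p 0 ^ 2 + A p 1 ^ 2 + A p 2 ^ 2 = 1 := by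
  have h1 : ‖A p‖ = 1 := by
    rw [A.norm_map]
    simpa [carrier] using hp
  have h2 := EuclideanSpace.real_norm_sq_eq (A p)
  rw [h1, Fin.sum_univ_three] at h2
  linarith

variable {A}

theorem coord_two_ne_one {N : E3} (hA : A N = EuclideanSpace.single 2 1) {p : E3}
    (hp : p ∈ sphere.carrier \ {N}) : A p 2 ≠ 1 := by
  intro h
  have h1 := sq_add_sq_add_sq A hp.1
  rw [h] at h1
  apply hp.2
  apply A.injective
  rw [hA]
  refine E3.ext_coord ?_ ?_ ?_
  · simp
    nlinarith [sq_nonneg (A p 1)]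
  · simp
    nlinarith [sq_nonneg (A p 0)]
  · simpa using h

theorem contDiff_coord_two : ContDiff ℝ 1 fun p : E3 => ((1 - A p 2 : ℝ) : ℂ) := by
  have h1 : ContDiff ℝ 1 fun p : E3 => A p 2 :=
    ((EuclideanSpace.proj (𝕜 := ℝ) (2 : Fin 3)).contDiff).comp A.contDiff
  exact Complex.ofRealCLM.contDiff.comp (contDiff_const.sub h1)

theorem contDiffAt_stereo {p : E3} (hp : A p 2 ≠ 1) : ContDiffAt ℝ 1 (stereo A) p := by
  have h1 : ContDiffAt ℝ 1 (fun p : E3 => ((1 - A p 2 : ℝ) : ℂ)⁻¹) p := by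
    refine contDiff_coord_two.contDiffAt.inv ?_
    exact Complex.ofReal_ne_zero.2 (sub_ne_zero.2 hp.symm)
  exact ((planeCoord.contDiff.comp A.contDiff).contDiffAt).mul h1

/-- The modulus of the projection determines the height `h`, through `|z|² = (1 + h) / (1 - h)`; the
height and `z` determine the other two coordinates. -/
theorem injOn_stereo {N : E3} (hA : A N = EuclideanSpace.single 2 1) :
    InjOn (stereo A) (sphere.carrier \ {N}) := by
  intro p hp q hq h
  have hp1 : 1 - A p 2 ≠ 0 := sub_ne_zero.2 (coord_two_ne_one hA hp).symm
  have hq1 : 1 - A q 2 ≠ 0 := sub_ne_zero.2 (coord_two_ne_one hA hq).symm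
  have h2 : planeCoord (A p) * ((1 - A q 2 : ℝ) : ℂ) =
      planeCoord (A q) * ((1 - A p 2 : ℝ) : ℂ) :=
    (div_eq_div_iff (Complex.ofReal_ne_zero.2 hp1) (Complex.ofReal_ne_zero.2 hq1)).1 h
  have hre := congrArg Complex.re h2
  have him := congrArg Complex.im h2
  rw [Complex.re_mul_ofReal, Complex.re_mul_ofReal, planeCoord_re, planeCoord_re] at hre
  rw [Complex.im_mul_ofReal, Complex.im_mul_ofReal, planeCoord_im, planeCoord_im] at him
  have sp := sq_add_sq_add_sq A hp.1
  have sq := sq_add_sq_add_sq A hq.1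
  have h3 : (1 - A p 2) * (1 - A q 2) * (2 * (A q 2 - A p 2)) = 0 := by
    linear_combination (-(A p 0 * (1 - A q 2) + A q 0 * (1 - A p 2))) * hre -
      (A p 1 * (1 - A q 2) + A q 1 * (1 - A p 2)) * him + (1 - A q 2) ^ 2 * sp -
      (1 - A p 2) ^ 2 * sq
  have h4 : A p 2 = A q 2 := by
    have := (mul_eq_zero.1 h3).resolve_left (mul_ne_zero hp1 hq1)
    linarith
  rw [h4] at hre him
  exact A.injective (E3.ext_coord (mul_right_cancel₀ hq1 hre) (mul_right_cancel₀ hq1 him) h4)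

/-- The infinitesimal form of the injectivity argument: a vanishing derivative first forces the
height component of `w` to vanish, then the other two. -/
theorem ker_fderiv_stereo {p : E3} (hp : p ∈ sphere.carrier) (hp1 : A p 2 ≠ 1) {w : E3}
    (hw : inner ℝ p w = 0) (h : fderiv ℝ (stereo A) p w = 0) : w = 0 := by
  have hl : HasDerivAt (fun t : ℝ => p + t • w) w 0 := by
    simpa using ((hasDerivAt_id (0 : ℝ)).smul_const w).const_add p
  have hm : 1 - A p 2 ≠ 0 := sub_ne_zero.2 hp1.symm
  have hmC : ((1 - A p 2 : ℝ) : ℂ) ≠ 0 := Complex.ofReal_ne_zero.2 hm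
  have h1 : HasDerivAt (fun t : ℝ => stereo A (p + t • w)) 0 0 := by
    have hd : HasFDerivAt (stereo A) (fderiv ℝ (stereo A) p) (p + (0 : ℝ) • w) := by
      rw [zero_smul, add_zero]
      exact ((contDiffAt_stereo hp1).differentiableAt one_ne_zero).hasFDerivAt
    have := hd.comp_hasDerivAt (0 : ℝ) hl
    rwa [h] at this
  have hAl : HasDerivAt (fun t : ℝ => A (p + t • w)) (A w) 0 :=
    A.toContinuousLinearEquiv.toContinuousLinearMap.hasFDerivAt.comp_hasDerivAt (0 : ℝ) hl
  have hnum : HasDerivAt (fun t : ℝ => planeCoord (A (p + t • w))) (planeCoord (A w)) 0 :=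
    planeCoord.hasFDerivAt.comp_hasDerivAt (0 : ℝ) hAl
  have hden : HasDerivAt (fun t : ℝ => ((1 - A (p + t • w) 2 : ℝ) : ℂ)) ((-(A w 2) : ℝ) : ℂ) 0 :=
    HasDerivAt.ofReal_comp (((EuclideanSpace.proj (𝕜 := ℝ) (2 : Fin 3)).hasFDerivAt.comp_hasDerivAt
      (0 : ℝ) hAl).const_sub 1)
  have hdiv := (hnum.div hden (by simpa using hmC)).unique h1
  simp only [zero_smul, add_zero] at hdiv
  have hdiv' := (div_eq_zero_iff.1 hdiv).resolve_right (pow_ne_zero 2 hmC)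
  have hre := congrArg Complex.re hdiv'
  have him := congrArg Complex.im hdiv'
  rw [Complex.sub_re, Complex.re_mul_ofReal, Complex.re_mul_ofReal, planeCoord_re, planeCoord_re,
    Complex.zero_re] at hre
  rw [Complex.sub_im, Complex.im_mul_ofReal, Complex.im_mul_ofReal, planeCoord_im, planeCoord_im,
    Complex.zero_im] at him
  have hin : A p 0 * A w 0 + A p 1 * A w 1 + A p 2 * A w 2 = 0 := by
    rw [← A.inner_map_map] at hw
    simp only [PiLp.inner_apply, Fin.sum_univ_three] at hw
    simp at hw
    linarith
  have sp := sq_add_sq_add_sq A hp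
  have h2 : (1 - A p 2) * A w 2 = 0 := by
    linear_combination A p 0 * hre + A p 1 * him - (1 - A p 2) * hin - A w 2 * sp
  have h2' : A w 2 = 0 := (mul_eq_zero.1 h2).resolve_left hm
  rw [h2'] at hre him
  simp only [neg_zero, mul_zero, sub_zero] at hre him
  apply A.injective
  rw [map_zero]
  exact E3.ext_coord ((mul_eq_zero.1 hre).resolve_right hm) ((mul_eq_zero.1 him).resolve_right hm)
    h2'

theorem tendsto_stereo_pole {N : E3} (hA : A N = EuclideanSpace.single 2 1) :
    Tendsto (stereo A) (𝓝[sphere.carrier \ {N}] N) (cocompact ℂ) := by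
  rw [← Metric.cobounded_eq_cocompact, ← tendsto_norm_atTop_iff_cobounded]
  have hA2 : Tendsto (fun p : E3 => A p 2) (𝓝[sphere.carrier \ {N}] N) (𝓝 1) := by
    have h1 : Continuous fun p : E3 => A p 2 :=
      (EuclideanSpace.proj (𝕜 := ℝ) (2 : Fin 3)).continuous.comp A.continuous
    have h2 := h1.tendsto N
    rw [hA] at h2
    simpa using h2.mono_left nhdsWithin_le_nhds
  have hlt : ∀ p ∈ sphere.carrier \ {N}, A p 2 < 1 := by
    intro p hp
    refine lt_of_le_of_ne ?_ (coord_two_ne_one hA hp)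
    nlinarith [sq_add_sq_add_sq A hp.1, sq_nonneg (A p 0), sq_nonneg (A p 1)]
  have h3 : Tendsto (fun p : E3 => 1 - A p 2) (𝓝[sphere.carrier \ {N}] N) (𝓝[>] 0) := by
    refine tendsto_nhdsWithin_iff.2 ⟨by simpa using hA2.const_sub 1, ?_⟩
    filter_upwards [self_mem_nhdsWithin] with p hp
    exact sub_pos.2 (hlt p hp)
  have h4 : Tendsto (fun p : E3 => (1 + A p 2) * (1 - A p 2)⁻¹) (𝓝[sphere.carrier \ {N}] N)
      atTop :=
    Tendsto.pos_mul_atTop (C := 1 + 1) (by norm_num) (hA2.const_add 1)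
      (tendsto_inv_nhdsGT_zero.comp h3)
  refine (Real.tendsto_sqrt_atTop.comp h4).congr' ?_
  filter_upwards [self_mem_nhdsWithin] with p hp
  have hm : 0 < 1 - A p 2 := sub_pos.2 (hlt p hp)
  have sp := sq_add_sq_add_sq A hp.1
  rw [Function.comp, stereo, norm_div, Complex.norm_real, Real.norm_of_nonneg hm.le,
    Complex.norm_def, Complex.normSq_apply, planeCoord_re, planeCoord_im,
    show A p 0 * A p 0 + A p 1 * A p 1 = (1 + A p 2) * (1 - A p 2)⁻¹ * (1 - A p 2) ^ 2 by
      field_simp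
      linear_combination sp, Real.sqrt_mul' _ (sq_nonneg _), Real.sqrt_sq hm.le]
  field_simp

end Stereographic

/-- The chart of the sphere by stereographic projection from a point. -/
theorem exists_sphereChart {N : E3} (hN : N ∈ sphere.carrier) :
    ∃ φ : PlaneChart sphere, φ.pole = {N} := by
  obtain ⟨b, hb⟩ := Orthonormal.exists_orthonormalBasis_extension_of_card_eq (𝕜 := ℝ) (E := E3)
    (ι := Fin 3) (by simp) (v := fun _ => N) (s := {2}) (by
      rw [orthonormal_iff_ite]
      rintro ⟨i, rfl⟩ ⟨j, rfl⟩
      have : ‖N‖ = 1 := by simpa [carrier] using hN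
      simp [this])
  have hA : b.repr N = EuclideanSpace.single 2 1 := by
    rw [← hb 2 rfl, b.repr_self]
  exact ⟨{  toFun := stereo b.repr
            pole := {N}
            finite_pole := finite_singleton N
            injOn := injOn_stereo hA
            contDiffAt := fun p hp => contDiffAt_stereo (coord_two_ne_one hA hp)
            tendsto_pole := by
              rintro p rfl
              exact tendsto_stereo_pole hA
            ker_fderiv := fun p hp w hw h =>
              ker_fderiv_stereo hp.1 (coord_two_ne_one hA hp) hw h }, rfl⟩

/-- Finitely many smooth curves miss a point of the sphere. -/
theorem exists_mem_sphere_notMem {l : ℕ} {c : Fin l → ℝ → E3} (hc : ∀ k, ContDiff ℝ 1 (c k)) :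
    ∃ N ∈ sphere.carrier, ∀ k s, c k s ≠ N := by
  -- The cones over the curves are smooth images of `ℝ²`, hence of dimension at most two. A nonzero
  -- point off them, once normalised, is a point of the sphere off the curves.
  have hf : ∀ k, ContDiff ℝ 1 fun q : ℝ × ℝ => q.1 • c k q.2 := fun k =>
    contDiff_fst.smul ((hc k).comp contDiff_snd)
  have hdim : dimH (⋃ k, range fun q : ℝ × ℝ => q.1 • c k q.2) < Module.finrank ℝ E3 := by
    refine lt_of_le_of_lt (b := (2 : ENNReal)) ?_ (by simp; norm_num)
    rw [dimH_iUnion]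
    refine iSup_le fun k => ?_
    simpa using (hf k).dimH_range_le
  have hdense := dense_compl_of_dimH_lt_finrank hdim
  obtain ⟨P, hP, hP0⟩ := hdense.exists_mem_open (isOpen_compl_singleton (x := (0 : E3)))
    ⟨EuclideanSpace.single 0 1, by simp⟩
  have hP0' : ‖P‖ ≠ 0 := norm_ne_zero_iff.2 hP0
  refine ⟨‖P‖⁻¹ • P, by simp [carrier, norm_smul, hP0'], fun k s hks => hP ?_⟩
  refine mem_iUnion.2 ⟨k, (‖P‖, s), ?_⟩
  simp only [hks]
  rw [smul_inv_smul₀ hP0']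

end DiagramSurface

/-! ### The diagram in a chart and the index of a region -/

namespace LinkDiagram

variable {S : DiagramSurface} (D : LinkDiagram S)

theorem hasDerivAt_curve (k : Fin D.l) (s : ℝ) :
    HasDerivAt (fun s : ℝ => D.curve k (s : UnitAddCircle))
      (D.velocity (k, (s : UnitAddCircle))) s := by
  have h1 := ((D.smooth k).differentiable (by simp)).differentiableAt (x := s) |>.hasDerivAt
  have h2 : HasDerivAt (fun t : ℝ => D.curve k ((s : UnitAddCircle) + (t : UnitAddCircle)))
      (deriv (fun s : ℝ => D.curve k (s : UnitAddCircle)) s) 0 :=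
    HasDerivAt.comp_const_add s 0 (by rwa [add_zero])
  rwa [velocity, h2.deriv]

theorem velocity_coe (k : Fin D.l) (s : ℝ) : D.velocity (k, (s : UnitAddCircle)) =
    deriv (fun s : ℝ => D.curve k (s : UnitAddCircle)) s :=
  (D.hasDerivAt_curve k s).deriv.symm

theorem continuous_of_lift {X : Type*} [TopologicalSpace X] {l : ℕ}
    {f : Fin l × UnitAddCircle → X}
    (h : ∀ k, Continuous fun s : ℝ => f (k, (s : UnitAddCircle))) : Continuous f := by
  refine continuous_prod_of_discrete_left.2 fun k => ?_
  exact (QuotientAddGroup.isQuotientMap_mk (N := AddSubgroup.zmultiples (1 : ℝ))).continuous_iff.2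
    (h k)

theorem continuous_proj : Continuous D.proj :=
  continuous_of_lift fun k => (D.smooth k).continuous

theorem continuous_velocity : Continuous D.velocity := by
  refine continuous_of_lift fun k => ?_
  simp only [velocity_coe]
  exact (D.smooth k).continuous_deriv (by simp)

theorem proj_mem (q : D.Param) : D.proj q ∈ S.carrier := D.mem_carrier _ _

theorem inner_normal_velocity (q : D.Param) : inner ℝ (S.normal (D.proj q)) (D.velocity q) = 0 := by
  obtain ⟨k, θ⟩ := q
  obtain ⟨s, rfl⟩ := QuotientAddGroup.mk_surjective θ
  exact S.inner_normal_deriv (D.hasDerivAt_curve k s) fun s => D.mem_carrier _ _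

/-- Every link diagram lies in the domain of a chart. -/
theorem exists_chart : ∃ φ : S.PlaneChart, ∀ q, D.proj q ∉ φ.pole := by
  cases S with
  | plane => exact ⟨DiagramSurface.planeChart, fun q => notMem_empty _⟩
  | sphere =>
    obtain ⟨N, hN, h⟩ := DiagramSurface.exists_mem_sphere_notMem
      (c := fun k (s : ℝ) => D.curve k (s : UnitAddCircle)) fun k => (D.smooth k).of_le (by simp)
    obtain ⟨φ, hφ⟩ := DiagramSurface.exists_sphereChart hN
    refine ⟨φ, ?_⟩
    rw [hφ]
    rintro ⟨k, θ⟩ hq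
    obtain ⟨s, rfl⟩ := QuotientAddGroup.mk_surjective θ
    exact h k s hq

variable {D} {φ : S.PlaneChart} (hφ : ∀ q, D.proj q ∉ φ.pole)

/-- The link projection in the coordinate of a chart. -/
noncomputable def planar : PlanarCurves D.l where
  pos q := φ.toFun (D.proj q)
  vel q := fderiv ℝ φ.toFun (D.proj q) (D.velocity q)
  continuous_pos := continuous_iff_continuousAt.2 fun q =>
    ContinuousAt.comp (φ.contDiffAt _ ⟨D.proj_mem q, hφ q⟩).continuousAt D.continuous_proj.continuousAt
  continuous_vel := by
    have h1 : Continuous fun q => fderiv ℝ φ.toFun (D.proj q) :=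
      continuous_iff_continuousAt.2 fun q => ContinuousAt.comp (g := fderiv ℝ φ.toFun)
        ((φ.contDiffAt _ ⟨D.proj_mem q, hφ q⟩).fderiv_right (m := 0) (by simp)).continuousAt
        D.continuous_proj.continuousAt
    exact h1.clm_apply D.continuous_velocity
  hasDerivAt k s :=
    ((φ.contDiffAt _ ⟨D.proj_mem _, hφ (k, (s : UnitAddCircle))⟩).differentiableAt
      one_ne_zero).hasFDerivAt.comp_hasDerivAt s (D.hasDerivAt_curve k s)

theorem planar_pos (q : D.Param) : (planar hφ).pos q = φ.toFun (D.proj q) := rfl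

theorem planar_vel (q : D.Param) :
    (planar hφ).vel q = fderiv ℝ φ.toFun (D.proj q) (D.velocity q) := rfl

theorem proj_eq_of_planar_eq {q q' : D.Param} (h : (planar hφ).pos q = (planar hφ).pos q') :
    D.proj q = D.proj q' :=
  φ.injOn ⟨D.proj_mem q, hφ q⟩ ⟨D.proj_mem q', hφ q'⟩ h

theorem notMem_range_planar {p : E3} (hp : p ∈ D.complement) (hpole : p ∉ φ.pole) :
    φ.toFun p ∉ range (planar hφ).pos := by
  rintro ⟨q, hq⟩
  exact hp.2 ⟨q, φ.injOn ⟨D.proj_mem q, hφ q⟩ ⟨hp.1, hpole⟩ hq⟩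

/-- A weighted logarithmic integral with integral periods is a function on the regions. -/
theorem exists_regionIndex {χ : D.Param → ℂ} (hχ : PlanarCurves.IsWeight χ)
    (hexp : ∀ z ∉ range (planar hφ).pos, Complex.exp ((planar hφ).logInt χ z) = 1) :
    ∃ v : D.Region → ℤ, ∀ R : D.Region, ∀ p ∈ R.1, p ∉ φ.pole →
      (planar hφ).logInt χ (φ.toFun p) = v R * (2 * Real.pi * Complex.I) := by
  classical
  -- The value `0` at a pole is the limit of the integral at infinity, so `f` is continuous there
  -- too and a region containing a pole needs no separate treatment.
  set f : E3 → ℂ := fun p => if p ∈ φ.pole then 0 else (planar hφ).logInt χ (φ.toFun p) with hf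
  have hint : ∀ p, ∃ n : ℤ, p ∈ D.complement → f p = n * (2 * Real.pi * Complex.I) := by
    intro p
    by_cases hp : p ∈ D.complement
    · by_cases hpole : p ∈ φ.pole
      · exact ⟨0, fun _ => by simp [hf, hpole]⟩
      · obtain ⟨n, hn⟩ := Complex.exp_eq_one_iff.1 (hexp _ (notMem_range_planar hφ hp hpole))
        exact ⟨n, fun _ => by simp only [hf, if_neg hpole, hn]⟩
    · exact ⟨0, fun h => absurd h hp⟩
  choose w hw using hint
  have hcont : ContinuousOn f D.complement := by
    intro p hp
    by_cases hpole : p ∈ φ.pole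
    · have h1 : Tendsto f (𝓝[S.carrier \ φ.pole] p) (𝓝 0) := by
        refine (((planar hφ).tendsto_logInt_cocompact hχ).comp (φ.tendsto_pole p hpole)).congr' ?_
        filter_upwards [self_mem_nhdsWithin] with q hq
        simp only [hf, if_neg hq.2, Function.comp]
      have h2 : Tendsto f (𝓝[φ.pole] p) (𝓝 0) := by
        refine tendsto_const_nhds.congr' ?_
        filter_upwards [self_mem_nhdsWithin] with q hq
        simp only [hf, if_pos hq]
      have h3 : Tendsto f (𝓝[S.carrier \ φ.pole ∪ φ.pole] p) (𝓝 0) := by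
        rw [nhdsWithin_union]
        exact h1.sup h2
      have h4 : f p = 0 := by simp only [hf, if_pos hpole]
      rw [ContinuousWithinAt, h4]
      refine h3.mono_left (nhdsWithin_mono p fun q hq => ?_)
      by_cases hq' : q ∈ φ.pole
      · exact Or.inr hq'
      · exact Or.inl ⟨hq.1, hq'⟩
    · obtain ⟨δ, hδ, hb⟩ :=
        (planar hφ).exists_dist_of_notMem_range (notMem_range_planar hφ hp hpole)
      have h1 := (planar hφ).continuousAt_logInt hχ hδ fun q _ => hb q
      have h2 : ContinuousAt (fun q => (planar hφ).logInt χ (φ.toFun q)) p :=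
        ContinuousAt.comp (g := (planar hφ).logInt χ) h1 (φ.contDiffAt p ⟨hp.1, hpole⟩).continuousAt
      refine (h2.congr ?_).continuousWithinAt
      filter_upwards [φ.finite_pole.isClosed.isOpen_compl.mem_nhds hpole] with q hq
      simp only [hf, if_neg hq]
  have hcontw : ContinuousOn w D.complement := by
    -- Continuity of the integer-valued `w` makes it constant on connected sets.
    rw [Int.isClosedEmbedding_coe_real.isInducing.continuousOn_iff]
    have h1 : ContinuousOn (fun p => (f p / (2 * Real.pi * Complex.I)).re) D.complement :=
      Complex.continuous_re.comp_continuousOn (hcont.div_const _)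
    refine h1.congr fun p hp => ?_
    simp only [hw p hp, mul_div_cancel_right₀ _ Complex.two_pi_I_ne_zero, Function.comp]
    simp
  refine ⟨fun R => w R.2.choose, fun R p hp hpole => ?_⟩
  obtain ⟨hq, hR⟩ := R.2.choose_spec
  have hsub : R.1 ⊆ D.complement := by
    rw [hR]
    exact connectedComponentIn_subset _ _
  have hpre : IsPreconnected R.1 := by
    rw [hR]
    exact isPreconnected_connectedComponentIn
  have hmem : R.2.choose ∈ R.1 := hR.superset (mem_connectedComponentIn hq)
  have hconst : w p = w R.2.choose := hpre.constant (hcontw.mono hsub) hp hmem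
  simp only [← hconst]
  rw [← hw p (hsub hp)]
  simp only [hf, if_neg hpole]

/-! ### Approaching a crossing inside a corner -/

namespace Crossing

/-- The direction inside a corner. -/
noncomputable def dir (x : D.Crossing) (κ : Corner) : E3 := x.underDir κ + x.overDir κ

/-- The path leaving the crossing inside a corner. -/
noncomputable def path (x : D.Crossing) (κ : Corner) (t : ℝ) : E3 :=
  S.retract (x.pt + t • x.dir κ)

variable (x : D.Crossing)

theorem pt_mem : x.pt ∈ S.carrier := D.proj_mem _

theorem pt_eq : x.pt = D.proj x.overPt := x.meet.symm

theorem overPt_ne_underPt : x.overPt ≠ x.underPt := fun h =>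
  x.under_not_mem (h ▸ x.over_mem)

theorem inner_normal_under : inner ℝ (S.normal x.pt) (D.velocity x.underPt) = 0 :=
  D.inner_normal_velocity _

theorem inner_normal_over : inner ℝ (S.normal x.pt) (D.velocity x.overPt) = 0 := by
  rw [pt_eq]
  exact D.inner_normal_velocity _

theorem linearIndependent_velocity :
    LinearIndependent ℝ ![D.velocity x.underPt, D.velocity x.overPt] :=
  D.transverse x.underPt x.overPt x.overPt_ne_underPt.symm x.meet.symm

theorem inner_normal_dir (κ : Corner) : inner ℝ (S.normal x.pt) (x.dir κ) = 0 := by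
  rw [dir, underDir, overDir, inner_add_right, ← Int.cast_smul_eq_zsmul ℝ,
    ← Int.cast_smul_eq_zsmul ℝ, inner_smul_right, inner_smul_right, x.inner_normal_under,
    x.inner_normal_over]
  simp

theorem path_mem (κ : Corner) (t : ℝ) : x.path κ t ∈ S.carrier :=
  S.retract_mem x.pt_mem (x.inner_normal_dir κ) t

theorem path_zero (κ : Corner) : x.path κ 0 = x.pt := by
  rw [path, zero_smul, add_zero, S.retract_zero x.pt_mem]

theorem continuous_path (κ : Corner) : Continuous (x.path κ) :=
  S.continuous_retract_line x.pt_mem (x.inner_normal_dir κ)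

theorem eq_over_or_under {q : D.Param} (h : D.proj q = x.pt) : q = x.overPt ∨ q = x.underPt := by
  rcases D.double q x.overPt x.underPt (h.trans x.pt_eq) x.meet with h | h | h
  · exact Or.inl h
  · exact absurd h x.overPt_ne_underPt
  · exact Or.inr h

/-- The planar velocity of the underpass. -/
noncomputable def underVel : ℂ := (planar hφ).vel x.underPt

/-- The planar velocity of the overpass. -/
noncomputable def overVel : ℂ := (planar hφ).vel x.overPt

theorem overVel_eq : x.overVel hφ = fderiv ℝ φ.toFun x.pt (D.velocity x.overPt) := by
  rw [overVel, planar_vel, pt_eq]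

theorem pt_mem_domain (h : ∀ q, D.proj q ∉ φ.pole) : x.pt ∈ S.carrier \ φ.pole :=
  ⟨x.pt_mem, h _⟩

open scoped ComplexConjugate in
-- The differential of the chart is injective on the tangent plane, so transversality survives: a
-- zero imaginary part would make the two velocities real multiples of each other.
theorem im_underVel_mul_conj_overVel : (x.underVel hφ * conj (x.overVel hφ)).im ≠ 0 := by
  intro h
  have hO : x.overVel hφ ≠ 0 := by
    rw [overVel_eq]
    intro h0
    exact x.linearIndependent_velocity.ne_zero 1
      (φ.ker_fderiv _ (x.pt_mem_domain hφ) _ x.inner_normal_over h0)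
  set r : ℝ := (x.underVel hφ * conj (x.overVel hφ)).re / Complex.normSq (x.overVel hφ) with hr
  have hn : (Complex.normSq (x.overVel hφ) : ℂ) ≠ 0 :=
    Complex.ofReal_ne_zero.2 (Complex.normSq_pos.2 hO).ne'
  have h1 : x.underVel hφ = r * x.overVel hφ := by
    have h2 : x.underVel hφ * conj (x.overVel hφ) =
        ((x.underVel hφ * conj (x.overVel hφ)).re : ℂ) := by
      apply Complex.ext
      · simp
      · rw [h, Complex.ofReal_im]
    rw [hr, Complex.ofReal_div, ← h2, div_mul_eq_mul_div, eq_div_iff hn, mul_assoc, mul_comm (conj _),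
      Complex.mul_conj]
  have h3 : fderiv ℝ φ.toFun x.pt (D.velocity x.underPt - r • D.velocity x.overPt) = 0 := by
    rw [map_sub, map_smul, ← x.overVel_eq hφ, Complex.real_smul, ← h1]
    exact sub_self _
  have h4 := φ.ker_fderiv _ (x.pt_mem_domain hφ) _ (by
    rw [inner_sub_right, inner_smul_right, x.inner_normal_under, x.inner_normal_over]
    simp) h3
  have h5 := (LinearIndependent.pair_iff.1 x.linearIndependent_velocity 1 (-r) (by
    rw [one_smul, neg_smul, ← sub_eq_add_neg, h4])).1
  exact one_ne_zero h5

/-- The coordinate direction of a corner. -/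
noncomputable def planarDir (κ : Corner) : ℂ :=
  PlanarCurves.cornerDir (x.underVel hφ) (x.overVel hφ) κ

theorem hasDerivAt_planar_path (κ : Corner) :
    HasDerivAt (fun t => φ.toFun (x.path κ t)) (x.planarDir hφ κ) 0 := by
  have h1 : HasFDerivAt φ.toFun (fderiv ℝ φ.toFun x.pt) (x.path κ 0) := by
    rw [path_zero]
    exact ((φ.contDiffAt _ (x.pt_mem_domain hφ)).differentiableAt one_ne_zero).hasFDerivAt
  have h2 := h1.comp_hasDerivAt (0 : ℝ)
    (S.hasDerivAt_retract_line x.pt_mem (x.inner_normal_dir κ) : HasDerivAt (x.path κ) _ 0)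
  refine h2.congr_deriv ?_
  rw [dir, underDir, overDir, map_add, map_zsmul, map_zsmul, ← x.overVel_eq hφ, planarDir,
    PlanarCurves.cornerDir, zsmul_eq_mul, zsmul_eq_mul]
  rfl

/-- The hypothesis `hsum` cancels the `log t` terms of the two strands. The constant `C` is common
to the four corners and disappears when they are compared. -/
theorem tendsto_logInt_path {χ : D.Param → ℂ} (hχ : PlanarCurves.IsWeight χ) {so su : ℝ}
    (hso : (so : UnitAddCircle) = x.overPt.2) (hsu : (su : UnitAddCircle) = x.underPt.2)
    {po mo pu mu : ℂ}
    (hpo : ∀ᶠ ε in 𝓝[>] (0 : ℝ), ∀ s ∈ Ioc so (so + ε), χ (x.overPt.1, (s : UnitAddCircle)) = po)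
    (hmo : ∀ᶠ ε in 𝓝[>] (0 : ℝ), ∀ s ∈ Ioc (so - ε) so, χ (x.overPt.1, (s : UnitAddCircle)) = mo)
    (hpu : ∀ᶠ ε in 𝓝[>] (0 : ℝ), ∀ s ∈ Ioc su (su + ε), χ (x.underPt.1, (s : UnitAddCircle)) = pu)
    (hmu : ∀ᶠ ε in 𝓝[>] (0 : ℝ), ∀ s ∈ Ioc (su - ε) su, χ (x.underPt.1, (s : UnitAddCircle)) = mu)
    (hsum : po - mo + (pu - mu) = 0) :
    ∃ C : ℂ, ∀ κ : Corner,
      (∀ᶠ t in 𝓝[>] (0 : ℝ), φ.toFun (x.path κ t) ∉ range (planar hφ).pos) ∧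
      Tendsto (fun t => (planar hφ).logInt χ (φ.toFun (x.path κ t))) (𝓝[>] 0)
        (𝓝 (C + ((po * Complex.log (-x.overVel hφ / x.planarDir hφ κ) -
            mo * Complex.log (x.overVel hφ / x.planarDir hφ κ)) +
          (pu * Complex.log (-x.underVel hφ / x.planarDir hφ κ) -
            mu * Complex.log (x.underVel hφ / x.planarDir hφ κ))))) := by
  have eo : ((x.overPt.1, (so : UnitAddCircle)) : D.Param) = x.overPt := by rw [hso]
  have eu : ((x.underPt.1, (su : UnitAddCircle)) : D.Param) = x.underPt := by rw [hsu]
  have key := (planar hφ).tendsto_logInt_doublePoint hχ (k := ![x.overPt.1, x.underPt.1])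
    (s₀ := ![so, su]) (z₀ := φ.toFun x.pt) (cp := ![po, pu]) (cm := ![mo, mu]) (ι := Corner)
    (p := fun κ t => φ.toFun (x.path κ t))
    (d := fun κ t => (φ.toFun (x.path κ t) - φ.toFun x.pt) / t) (d₀ := x.planarDir hφ)
    ?_ ?_ ?_ ?_ ?_ ?_ ?_ ?_
  · simp only [Fin.sum_univ_two, Matrix.cons_val_zero, Matrix.cons_val_one, eo, eu, hsum,
      zero_mul, add_zero] at key
    exact key
  · simp only [Matrix.cons_val_zero, Matrix.cons_val_one, eo, eu]
    exact x.overPt_ne_underPt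
  · rw [Fin.forall_fin_two]
    simp only [Matrix.cons_val_zero, Matrix.cons_val_one, eo, eu]
    exact ⟨by rw [pt_eq]; rfl, rfl⟩
  · intro q hq
    rw [Fin.exists_fin_two]
    simp only [Matrix.cons_val_zero, Matrix.cons_val_one, eo, eu]
    exact x.eq_over_or_under (proj_eq_of_planar_eq hφ (q' := x.underPt) hq)
  · rw [Fin.forall_fin_two]
    exact ⟨hpo, hpu⟩
  · rw [Fin.forall_fin_two]
    exact ⟨hmo, hmu⟩
  · intro κ t ht
    have : (t : ℂ) ≠ 0 := by exact_mod_cast ht.ne'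
    field_simp
    ring
  · intro κ
    have h1 := (hasDerivAt_iff_tendsto_slope.1 (x.hasDerivAt_planar_path hφ κ)).mono_left
      (nhdsWithin_mono 0 (fun t (ht : t ∈ Ioi (0 : ℝ)) => ne_of_gt ht))
    refine h1.congr fun t => ?_
    simp [slope, path_zero, div_eq_inv_mul]
  · intro κ
    have hX := x.im_underVel_mul_conj_overVel hφ
    have hpos := PlanarCurves.normSq_cornerDir_pos hX κ
    rw [Fin.forall_fin_two]
    simp only [Matrix.cons_val_zero, Matrix.cons_val_one, eo, eu]
    constructor
    · refine (PlanarCurves.im_div_cornerDir_right (x.underVel hφ) (x.overVel hφ) κ).trans_ne ?_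
      exact div_ne_zero (mul_ne_zero (neg_ne_zero.2 (PlanarCurves.intUnit_ne_zero _)) hX) hpos.ne'
    · refine (PlanarCurves.im_div_cornerDir_left (x.underVel hφ) (x.overVel hφ) κ).trans_ne ?_
      exact div_ne_zero (mul_ne_zero (PlanarCurves.intUnit_ne_zero _) hX) hpos.ne'

end Crossing

end LinkDiagram

/-! ### The weight of an arc near a crossing -/

namespace PlanarCurves

variable {l : ℕ}

/-- The indicator of an arc shorter than the circle is locally constant off its endpoints. -/
theorem eventually_indicator_arc_const {k : Fin l} {a b : ℝ} (hab : a < b) (hb : b < a + 1)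
    {q : Fin l × UnitAddCircle} (ha' : q ≠ (k, (a : UnitAddCircle)))
    (hb' : q ≠ (k, (b : UnitAddCircle))) :
    ∃ (s : ℝ) (c : ℂ), (s : UnitAddCircle) = q.2 ∧ ∀ᶠ ε in 𝓝[>] (0 : ℝ),
      ∀ s' ∈ Icc (s - ε) (s + ε), (arc k a b).indicator (fun _ => (1 : ℂ)) (q.1, ↑s') = c := by
  obtain ⟨j, θ⟩ := q
  have hmem : θ ∈ (fun s : ℝ => (s : UnitAddCircle)) '' Ioc a (a + 1) := by
    have := AddCircle.coe_image_Ioc_eq (1 : ℝ) a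
    exact this.symm ▸ mem_univ θ
  obtain ⟨s, hs, rfl⟩ := hmem
  by_cases hj : j = k
  · subst hj
    have hsb : s ≠ b := by
      rintro rfl
      exact hb' rfl
    have hsa : s ≠ a + 1 := by
      rintro rfl
      apply ha'
      simp only [AddCircle.coe_add, AddCircle.coe_period, add_zero]
    have hs1 : s < a + 1 := lt_of_le_of_ne hs.2 hsa
    rcases lt_or_gt_of_ne hsb with h | h
    · refine ⟨s, 1, rfl, ?_⟩
      filter_upwards [Ioo_mem_nhdsGT (show 0 < min (s - a) (b - s) from
        lt_min (by linarith [hs.1]) (by linarith))] with ε hε s' hs'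
      have h1 := hε.2.trans_le (min_le_left _ _)
      have h2 := hε.2.trans_le (min_le_right _ _)
      refine indicator_of_mem ((mem_arc_iff hb.le ⟨?_, ?_⟩).2 ⟨?_, ?_⟩) _ <;>
        linarith [hs'.1, hs'.2]
    · refine ⟨s, 0, rfl, ?_⟩
      filter_upwards [Ioo_mem_nhdsGT (show 0 < min (s - b) (a + 1 - s) from
        lt_min (by linarith) (by linarith))] with ε hε s' hs'
      have h1 := hε.2.trans_le (min_le_left _ _)
      have h2 := hε.2.trans_le (min_le_right _ _)
      exact indicator_of_notMem (mt (mem_arc_iff hb.le ⟨by linarith [hs'.1], by linarith [hs'.2]⟩).1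
        fun hc => by linarith [hs'.1, hc.2]) _
  · exact ⟨s, 0, rfl, Eventually.of_forall fun ε s' _ =>
      indicator_of_notMem (fun hmem => hj hmem.1) _⟩

theorem indicator_arc_start {k : Fin l} {a b : ℝ} (hab : a < b) (hb : b < a + 1) :
    (∀ᶠ ε in 𝓝[>] (0 : ℝ), ∀ s ∈ Ioc a (a + ε),
      (arc k a b).indicator (fun _ => (1 : ℂ)) (k, ↑s) = 1) ∧
    (∀ᶠ ε in 𝓝[>] (0 : ℝ), ∀ s ∈ Ioc (a - ε) a,
      (arc k a b).indicator (fun _ => (1 : ℂ)) (k, ↑s) = 0) := by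
  constructor
  · filter_upwards [Ioo_mem_nhdsGT (sub_pos.2 hab)] with ε hε s hs
    exact indicator_of_mem ((mem_arc_iff hb.le ⟨hs.1, by linarith [hs.2, hε.2]⟩).2
      ⟨hs.1, by linarith [hs.2, hε.2]⟩) _
  · filter_upwards [Ioo_mem_nhdsGT (show 0 < a + 1 - b by linarith)] with ε hε s hs
    -- Points just before `a` are represented just before `a + 1`, in the fundamental interval,
    -- where they lie beyond `b`.
    have h1 : (s : UnitAddCircle) = ((s + 1 : ℝ) : UnitAddCircle) := by
      rw [AddCircle.coe_add, AddCircle.coe_period, add_zero]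
    rw [h1]
    exact indicator_of_notMem (mt (mem_arc_iff hb.le
      ⟨by linarith [hs.1, hε.2], by linarith [hs.2]⟩).1 fun hc => by linarith [hs.1, hε.2, hc.2]) _

theorem indicator_arc_end {k : Fin l} {a b : ℝ} (hab : a < b) (hb : b < a + 1) :
    (∀ᶠ ε in 𝓝[>] (0 : ℝ), ∀ s ∈ Ioc b (b + ε),
      (arc k a b).indicator (fun _ => (1 : ℂ)) (k, ↑s) = 0) ∧
    (∀ᶠ ε in 𝓝[>] (0 : ℝ), ∀ s ∈ Ioc (b - ε) b,
      (arc k a b).indicator (fun _ => (1 : ℂ)) (k, ↑s) = 1) := by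
  constructor
  · filter_upwards [Ioo_mem_nhdsGT (show 0 < a + 1 - b by linarith)] with ε hε s hs
    exact indicator_of_notMem (mt (mem_arc_iff hb.le
      ⟨by linarith [hs.1], by linarith [hs.2, hε.2]⟩).1 fun hc => by linarith [hs.1, hc.2]) _
  · filter_upwards [Ioo_mem_nhdsGT (sub_pos.2 hab)] with ε hε s hs
    exact indicator_of_mem ((mem_arc_iff hb.le ⟨by linarith [hs.1, hε.2], by linarith [hs.2]⟩).2
      ⟨by linarith [hs.1, hε.2], hs.2⟩) _

end PlanarCurves

/-! ### Regions at the corners and rows of the matrix -/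

namespace LinkDiagram

variable {S : DiagramSurface} {D : LinkDiagram S}

namespace Crossing

variable (x : D.Crossing)

theorem exists_path_mem_complement (κ : Corner) : ∃ δ > 0, ∀ t ∈ Ioo 0 δ, x.path κ t ∈ D.complement := by
  obtain ⟨φ, hφ⟩ := D.exists_chart
  obtain ⟨so, hso⟩ := QuotientAddGroup.mk_surjective x.overPt.2
  obtain ⟨su, hsu⟩ := QuotientAddGroup.mk_surjective x.underPt.2
  -- Only the avoidance of the curves is needed here; the constant weight satisfies the remaining
  -- conditions trivially.
  obtain ⟨C, hC⟩ := x.tendsto_logInt_path hφ PlanarCurves.IsWeight.one hso hsu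
    (Eventually.of_forall fun _ _ _ => rfl) (Eventually.of_forall fun _ _ _ => rfl)
    (Eventually.of_forall fun _ _ _ => rfl) (Eventually.of_forall fun _ _ _ => rfl) (by ring)
  obtain ⟨δ, hδ, h⟩ := mem_nhdsGT_iff_exists_Ioo_subset.1 (hC κ).1
  refine ⟨δ, hδ, fun t ht => ⟨x.path_mem κ t, ?_⟩⟩
  rintro ⟨q, hq⟩
  exact h ht ⟨q, by rw [planar_pos, hq]⟩

/-- Some region touches a crossing at a given corner. -/
theorem exists_touches (κ : Corner) : ∃ R : D.Region, x.Touches R κ := by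
  obtain ⟨δ, hδ, h⟩ := x.exists_path_mem_complement κ
  have hmid : δ / 2 ∈ Ioo 0 δ := ⟨by linarith, by linarith⟩
  refine ⟨⟨connectedComponentIn D.complement (x.path κ (δ / 2)), _, h _ hmid, rfl⟩, ?_⟩
  have hsub : x.path κ '' Ioo 0 δ ⊆ connectedComponentIn D.complement (x.path κ (δ / 2)) :=
    (isPreconnected_Ioo.image _ (x.continuous_path κ).continuousOn).subset_connectedComponentIn
      ⟨_, hmid, rfl⟩ (image_subset_iff.2 h)
  filter_upwards [Ioo_mem_nhdsGT hδ] with t ht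
  exact hsub ⟨t, ht, rfl⟩

theorem eventually_path_notMem_pole {φ : S.PlaneChart} (hφ : ∀ q, D.proj q ∉ φ.pole) (κ : Corner) :
    ∀ᶠ t in 𝓝[>] (0 : ℝ), x.path κ t ∉ φ.pole := by
  have h1 : Tendsto (x.path κ) (𝓝[>] 0) (𝓝 x.pt) := by
    have := (x.continuous_path κ).tendsto 0
    rw [path_zero] at this
    exact this.mono_left nhdsWithin_le_nhds
  exact h1.eventually (φ.finite_pole.isClosed.isOpen_compl.mem_nhds (x.pt_mem_domain hφ).2)

theorem regionIndex_eq_of_tendsto {φ : S.PlaneChart} (hφ : ∀ q, D.proj q ∉ φ.pole)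
    {χ : D.Param → ℂ} {v : D.Region → ℤ}
    (hv : ∀ R : D.Region, ∀ p ∈ R.1, p ∉ φ.pole →
      (planar hφ).logInt χ (φ.toFun p) = v R * (2 * Real.pi * Complex.I))
    {κ : Corner} {R : D.Region} (hR : x.Touches R κ) {L : ℂ}
    (hL : Tendsto (fun t => (planar hφ).logInt χ (φ.toFun (x.path κ t))) (𝓝[>] 0) (𝓝 L)) :
    v R * (2 * Real.pi * Complex.I) = L := by
  refine tendsto_nhds_unique (tendsto_const_nhds.congr' ?_) hL
  filter_upwards [hR, x.eventually_path_notMem_pole hφ κ] with t ht hpole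
  exact (hv R _ ht hpole).symm

open scoped ComplexConjugate in
-- The sign is that of the crossing as seen in the chart. It is not compared with the sign of
-- `area`, since a chart may reverse orientation; this leaves a global sign to be fixed at the end.
theorem exists_sign {φ : S.PlaneChart} (hφ : ∀ q, D.proj q ∉ φ.pole) :
    ∃ s : ℤ, (((s : ℝ) = 1) ∨ ((s : ℝ) = -1)) ∧
      0 < (s : ℝ) * (x.underVel hφ * conj (x.overVel hφ)).im := by
  rcases lt_or_gt_of_ne (x.im_underVel_mul_conj_overVel hφ) with h | h
  · exact ⟨-1, Or.inr (by simp), by simpa using h⟩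
  · exact ⟨1, Or.inl (by simp), by simpa using h⟩

/-- A region touches a crossing only at corners of the same sign. -/
theorem Touches.sign_unique {x : D.Crossing} {R : D.Region} {κ κ' : Corner} (h : x.Touches R κ)
    (h' : x.Touches R κ') : κ.1 * κ.2 = κ'.1 * κ'.2 := by
  obtain ⟨φ, hφ⟩ := D.exists_chart
  obtain ⟨so, hso⟩ := QuotientAddGroup.mk_surjective x.overPt.2
  obtain ⟨su, hsu⟩ := QuotientAddGroup.mk_surjective x.underPt.2
  obtain ⟨C, hC⟩ := x.tendsto_logInt_path hφ PlanarCurves.IsWeight.one hso hsu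
    (Eventually.of_forall fun _ _ _ => rfl) (Eventually.of_forall fun _ _ _ => rfl)
    (Eventually.of_forall fun _ _ _ => rfl) (Eventually.of_forall fun _ _ _ => rfl) (by ring)
  obtain ⟨v, hv⟩ := exists_regionIndex hφ PlanarCurves.IsWeight.one
    fun z hz => (planar hφ).exp_logInt_one hz
  obtain ⟨s, hs, hpos⟩ := x.exists_sign hφ
  have e := (x.regionIndex_eq_of_tendsto hφ hv h (hC κ).2).symm.trans
    (x.regionIndex_eq_of_tendsto hφ hv h' (hC κ').2)
  simp only [one_mul, planarDir, PlanarCurves.log_sub_log_left hs hpos,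
    PlanarCurves.log_sub_log_right hs hpos] at e
  have hs0 : (s : ℂ) ≠ 0 := by
    have h1 : (s : ℝ) ≠ 0 := by rcases hs with h1 | h1 <;> simp [h1]
    exact_mod_cast h1
  -- The index of the whole link at a corner is, up to a constant and a sign, `(κ.1 - κ.2) / 2`.
  -- This is `0` when `κ.1 * κ.2 = 1` and `±1` otherwise, so it determines the sign of the corner.
  have e2 : ((κ.1 : ℤ) : ℂ) - (κ.2 : ℤ) = (κ'.1 : ℤ) - (κ'.2 : ℤ) := by
    have hne : (Real.pi * s * Complex.I : ℂ) ≠ 0 :=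
      mul_ne_zero (mul_ne_zero (Complex.ofReal_ne_zero.2 Real.pi_ne_zero) hs0) Complex.I_ne_zero
    refine mul_left_cancel₀ hne ?_
    push_cast at e
    linear_combination e
  have e3 : (κ.1 : ℤ) - κ.2 = κ'.1 - κ'.2 := by exact_mod_cast e2
  rcases κ with ⟨a, b⟩
  rcases κ' with ⟨a', b'⟩
  rcases Int.units_eq_one_or a with rfl | rfl <;> rcases Int.units_eq_one_or b with rfl | rfl <;>
  rcases Int.units_eq_one_or a' with rfl | rfl <;> rcases Int.units_eq_one_or b' with rfl | rfl <;>
  simp_all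

theorem exists_corner_iff {P : Corner → Prop} :
    (∃ κ, P κ) ↔ P (1, 1) ∨ P (-1, -1) ∨ P (1, -1) ∨ P (-1, 1) := by
  constructor
  · rintro ⟨⟨a, b⟩, h⟩
    rcases Int.units_eq_one_or a with rfl | rfl <;> rcases Int.units_eq_one_or b with rfl | rfl <;>
    simp [h]
  · rintro (h | h | h | h) <;> exact ⟨_, h⟩

theorem area_corner (κ : Corner) : S.area x.pt (x.underDir κ) (x.overDir κ) =
    ((κ.1 : ℤ) * (κ.2 : ℤ) : ℤ) * S.area x.pt (D.velocity x.underPt) (D.velocity x.overPt) :=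
  S.area_smul_smul _ _ _ _ _

theorem area_ne_zero : S.area x.pt (D.velocity x.underPt) (D.velocity x.overPt) ≠ 0 :=
  S.area_ne_zero x.pt_mem x.inner_normal_under x.inner_normal_over x.linearIndependent_velocity

open Classical in
-- By `Touches.sign_unique` a region touches no two adjacent corners, so the only possible
-- repetition is at opposite ones. The factor `2` counts exactly that, and the entry counts corners
-- with sign and multiplicity.
theorem altMatrix2_eq {r : Corner → D.Region} (hr : ∀ κ, x.Touches (r κ) κ) (R : D.Region) :
    D.altMatrix2 x R =
      (if 0 < S.area x.pt (D.velocity x.underPt) (D.velocity x.overPt) then 1 else -1) *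
        PlanarCurves.altSum fun κ => if r κ = R then (1 : ℤ) else 0 := by
  have ht : ∀ κ, x.Touches R κ ↔ r κ = R := fun κ =>
    ⟨fun h => (hr κ).unique h, fun h => h ▸ hr κ⟩
  have hd : ∀ κ κ' : Corner, r κ = R → r κ' = R → κ.1 * κ.2 = κ'.1 * κ'.2 := fun κ κ' h h' =>
    ((ht κ).2 h).sign_unique ((ht κ').2 h')
  have d1 := hd (1, 1) (1, -1)
  have d2 := hd (1, 1) (-1, 1)
  have d3 := hd (-1, -1) (1, -1)
  have d4 := hd (-1, -1) (-1, 1)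
  have hneg : (1 : ℤˣ) ≠ -1 := by decide
  have hA := x.area_ne_zero
  simp only [altMatrix2, altMatrix1, Matrix.of_apply, exists_corner_iff, ht, PosCorner, NegCorner,
    area_corner, PlanarCurves.altSum]
  generalize S.area x.pt (D.velocity x.underPt) (D.velocity x.overPt) = A at hA ⊢
  clear hd ht hr
  rcases lt_or_gt_of_ne hA with h | h
  · have h' : ¬ 0 < A := h.le.not_gt
    clear hA
    by_cases c1 : r (1, 1) = R <;> by_cases c2 : r (-1, -1) = R <;>
    by_cases c3 : r (1, -1) = R <;> by_cases c4 : r (-1, 1) = R <;>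
    simp_all [-not_lt]
  · have h' : ¬ A < 0 := h.le.not_gt
    clear hA
    by_cases c1 : r (1, 1) = R <;> by_cases c2 : r (-1, -1) = R <;>
    by_cases c3 : r (1, -1) = R <;> by_cases c4 : r (-1, 1) = R <;>
    simp_all [-not_lt]

/-- A component of the matrix product is, up to the sign of the crossing, the alternating sum of
the values at the four corners. -/
theorem exists_altMatrix2MulVec_eq : ∃ η : ℤ, (η = 1 ∨ η = -1) ∧
    ∀ r : Corner → D.Region, (∀ κ, x.Touches (r κ) κ) → ∀ v : D.Region → ℤ,
      D.altMatrix2MulVec v x = η * PlanarCurves.altSum fun κ => v (r κ) := by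
  classical
  refine ⟨if 0 < S.area x.pt (D.velocity x.underPt) (D.velocity x.overPt) then 1 else -1, ?_,
    fun r hr v => ?_⟩
  · split_ifs <;> simp
  have hsingle : ∀ κ, v (r κ) =
      ∑ R ∈ Finset.univ.image r, (if r κ = R then (1 : ℤ) else 0) * v R := by
    intro κ
    simp
  have hsupp : (Function.support fun R => D.altMatrix2 x R * v R) ⊆
      (Finset.univ.image r : Finset D.Region) := by
    intro R hR
    by_contra hcon
    have h0 : ∀ κ, r κ ≠ R := by simpa using hcon
    exact hR (by simp [x.altMatrix2_eq hr, PlanarCurves.altSum, h0])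
  rw [altMatrix2MulVec, finsum_eq_sum_of_support_subset _ hsupp]
  simp only [x.altMatrix2_eq hr, mul_assoc]
  rw [← Finset.mul_sum]
  simp only [PlanarCurves.altSum, hsingle, sub_mul, add_mul, Finset.sum_sub_distrib,
    Finset.sum_add_distrib]

end Crossing

end LinkDiagram

/-! ### The index of the loop at a self-crossing -/

theorem mainTheorem8 (S : DiagramSurface) (D : LinkDiagram S) (x : D.Crossing)
    (hx : x.IsSelfCrossing) :
    ∃ v : D.Region → ℤ,
      D.altMatrix2MulVec v x = 1 ∧
        ∀ y : D.Crossing, y ≠ x → D.altMatrix2MulVec v y = 0 := by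
  obtain ⟨φ, hφ⟩ := D.exists_chart
  set k := x.overPt.1 with hk
  obtain ⟨a, ha⟩ := QuotientAddGroup.mk_surjective x.overPt.2
  -- The arc from `a` to `b` runs from the overpass to the next visit of `x`, on the underpass,
  -- within one period.
  obtain ⟨b, hb, hbu⟩ : x.underPt.2 ∈ (fun s : ℝ => (s : UnitAddCircle)) '' Ioc a (a + 1) :=
    (AddCircle.coe_image_Ioc_eq (1 : ℝ) a).symm ▸ mem_univ _
  have hover : x.overPt = (k, (a : UnitAddCircle)) := Prod.ext rfl ha.symm
  have hunder : x.underPt = (k, (b : UnitAddCircle)) := Prod.ext hx.symm hbu.symm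
  have hb1 : b < a + 1 := by
    refine lt_of_le_of_ne hb.2 ?_
    rintro rfl
    apply x.overPt_ne_underPt
    rw [hover, hunder, AddCircle.coe_add, AddCircle.coe_period, add_zero]
  have hw : PlanarCurves.IsWeight ((PlanarCurves.arc k a b).indicator fun _ => (1 : ℂ)) :=
    PlanarCurves.IsWeight.one.indicator (PlanarCurves.measurableSet_arc k hb1.le)
  obtain ⟨v, hv⟩ := LinkDiagram.exists_regionIndex hφ hw fun z hz =>
    (LinkDiagram.planar hφ).exp_logInt_arc hb.1.le hb1.le (by
      rw [← hover, ← hunder, LinkDiagram.planar_pos, LinkDiagram.planar_pos, x.meet]) hz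
  have htwo : (2 * Real.pi * Complex.I : ℂ) ≠ 0 := Complex.two_pi_I_ne_zero
  choose r hr using fun (y : D.Crossing) => fun κ => y.exists_touches κ
  have hyzero : ∀ y : D.Crossing, y ≠ x → D.altMatrix2MulVec v y = 0 := by
    intro y hy
    obtain ⟨η, -, hη⟩ := y.exists_altMatrix2MulVec_eq
    rw [hη (r y) (hr y) v]
    -- No pass of `y` is an end of the arc, so the weight is constant along each strand near `y`.
    have hoo : y.overPt ≠ x.overPt := by
      intro h
      refine hy (LinkDiagram.Crossing.ext h ?_)
      have h1 : D.proj y.underPt = x.pt := by rw [← y.meet, h, x.pt_eq]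
      rcases x.eq_over_or_under h1 with h2 | h2
      · exact absurd (h2 ▸ x.over_mem) y.under_not_mem
      · exact h2
    have huu : y.underPt ≠ x.underPt := by
      intro h
      refine hy (LinkDiagram.Crossing.ext ?_ h)
      have h1 : D.proj y.overPt = x.pt := by rw [y.meet, h]; rfl
      rcases x.eq_over_or_under h1 with h2 | h2
      · exact h2
      · exact absurd (h2 ▸ y.over_mem) x.under_not_mem
    have hou : y.overPt ≠ x.underPt := fun h => x.under_not_mem (h ▸ y.over_mem)
    have huo : y.underPt ≠ x.overPt := fun h => y.under_not_mem (h ▸ x.over_mem)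
    rw [hover] at hoo huo
    rw [hunder] at huu hou
    obtain ⟨so, co, hso, hco⟩ := PlanarCurves.eventually_indicator_arc_const hb.1 hb1 hoo hou
    obtain ⟨su, cu, hsu, hcu⟩ := PlanarCurves.eventually_indicator_arc_const hb.1 hb1 huo huu
    obtain ⟨C, hC⟩ := y.tendsto_logInt_path hφ hw hso hsu (po := co) (mo := co) (pu := cu)
      (mu := cu)
      (by filter_upwards [hco, self_mem_nhdsWithin] with ε h (hε : 0 < ε) s hs
          exact h s ⟨by linarith [hs.1], hs.2⟩)
      (by filter_upwards [hco, self_mem_nhdsWithin] with ε h (hε : 0 < ε) s hs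
          exact h s ⟨hs.1.le, by linarith [hs.2]⟩)
      (by filter_upwards [hcu, self_mem_nhdsWithin] with ε h (hε : 0 < ε) s hs
          exact h s ⟨by linarith [hs.1], hs.2⟩)
      (by filter_upwards [hcu, self_mem_nhdsWithin] with ε h (hε : 0 < ε) s hs
          exact h s ⟨hs.1.le, by linarith [hs.2]⟩) (by ring)
    obtain ⟨s, hs, hpos⟩ := y.exists_sign hφ
    have e := fun κ => y.regionIndex_eq_of_tendsto hφ hv (hr y κ) (hC κ).2
    simp only [← mul_sub, LinkDiagram.Crossing.planarDir,
      PlanarCurves.log_sub_log_left hs hpos, PlanarCurves.log_sub_log_right hs hpos] at e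
    -- The four values are now affine in `κ.1` and `κ.2`; the alternating sum sees only a `κ.1 *
    -- κ.2` term, which is absent.
    have hzero : PlanarCurves.altSum (fun κ => v (r y κ)) = 0 := by
      have e1 := e (1, 1)
      have e2 := e (-1, -1)
      have e3 := e (1, -1)
      have e4 := e (-1, 1)
      push_cast at e1 e2 e3 e4
      have : (((v (r y (1, 1)) + v (r y (-1, -1)) - v (r y (1, -1)) - v (r y (-1, 1)) : ℤ)) : ℂ) *
          (2 * Real.pi * Complex.I) = 0 := by
        push_cast
        linear_combination e1 + e2 - e3 - e4
      exact_mod_cast (mul_eq_zero.1 this).resolve_right htwo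
    rw [hzero, mul_zero]
  have hxone : D.altMatrix2MulVec v x = 1 ∨ D.altMatrix2MulVec v x = -1 := by
    obtain ⟨η, hη1, hη⟩ := x.exists_altMatrix2MulVec_eq
    rw [hη (r x) (hr x) v]
    have hstart := PlanarCurves.indicator_arc_start (k := k) hb.1 hb1
    have hend := PlanarCurves.indicator_arc_end (k := k) hb.1 hb1
    have hk' : x.underPt.1 = k := hx.symm
    -- The weight jumps from `0` to `1` on the overpass, where the arc starts, and from `1` to `0`
    -- on the underpass, where it ends; the jumps cancel.
    obtain ⟨C, hC⟩ := x.tendsto_logInt_path hφ hw ha hbu hstart.1 hstart.2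
      (by rw [hk']; exact hend.1) (by rw [hk']; exact hend.2) (by ring)
    obtain ⟨s, hs, hpos⟩ := x.exists_sign hφ
    have e := fun κ => x.regionIndex_eq_of_tendsto hφ hv (hr x κ) (hC κ).2
    have hturn := PlanarCurves.altSum_turn hs hpos
    have hs' : s = 1 ∨ s = -1 := hs.imp (fun h => by exact_mod_cast h) fun h => by exact_mod_cast h
    have hval : PlanarCurves.altSum (fun κ => v (r x κ)) = s := by
      have e1 := e (1, 1)
      have e2 := e (-1, -1)
      have e3 := e (1, -1)
      have e4 := e (-1, 1)
      simp only [LinkDiagram.Crossing.planarDir] at e1 e2 e3 e4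
      simp only [PlanarCurves.altSum, Complex.ofReal_intCast] at hturn
      have : (((v (r x (1, 1)) + v (r x (-1, -1)) - v (r x (1, -1)) - v (r x (-1, 1)) : ℤ)) : ℂ) *
          (2 * Real.pi * Complex.I) = (s : ℂ) * (2 * Real.pi * Complex.I) := by
        push_cast
        linear_combination e1 + e2 - e3 - e4 + hturn
      exact_mod_cast mul_right_cancel₀ htwo this
    rw [hval]
    rcases hη1 with rfl | rfl <;> rcases hs' with rfl | rfl <;> simp
  rcases hxone with h | h
  · exact ⟨v, h, hyzero⟩
  -- If the signs of the crossing and of the chart disagree, the opposite vector is used.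
  · have hneg : ∀ y : D.Crossing, D.altMatrix2MulVec (-v) y = -D.altMatrix2MulVec v y := by
      intro y
      obtain ⟨η, -, hη⟩ := y.exists_altMatrix2MulVec_eq
      rw [hη (r y) (hr y), hη (r y) (hr y)]
      simp only [PlanarCurves.altSum, Pi.neg_apply]
      ring
    exact ⟨-v, by rw [hneg, h, neg_neg], fun y hy => by rw [hneg, hyzero y hy, neg_zero]⟩
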